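/- Let $n\ge 0$ and let $W(A_n)$ be the Coxeter group of type $A_n$, with Coxeter generators $\sigma_1,\dots,\sigma_n$ (in the order of the Coxeter graph). For $1\le i\le j\le n$ put $[i,j]=\sigma_i\sigma_{i+1}\cdots\sigma_j$. An element of $W(A_n)$ is fully commutative if any two of its reduced expressions can be transformed into each other by commutation relations only. A non-crossing diagram $D$ on $n+1$ strings consists of a top row of dots $1,\dots,n+1$ and a bottom row of dots $1',\dots,(n+1)'$, numbered from left to right, in which each dot is joined to exactly one other dot, by joins that do not intersect when drawn in the rectangle spanned by the two rows. With the order $1<\dots<n+1<1'<\dots<(n+1)'$, each join is an arrow $(x,y)$ with $x<y$, tail $x$ and head $y$, and $D$ is regarded as a set of arrows. Let $AD$ (resp. $BD$) be the set of arrows of $D$ with both endpoints in the top (resp. bottom) row, and $D^+$ the set of arrows $(x,y)$ of $D$ with $x$ in the top row, $y$ in the bottom row and $x'<y$. Put $$\mathcal I(D)=\{i : i \text{ is the tail of an arrow of } AD\cup D^+\},\qquad \mathcal J(D)=\{j : (j+1)' \text{ is the head of an arrow of } BD\cup D^+\},$$ and call $\sharp(AD\cup D^+)$ the size of $D$. The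 product of two diagrams is $D_1D_2=\delta^{m}\,D_1\ast D_2$, where $D_1\ast D_2$ is obtained by placing $D_2$ below $D_1$ and deleting the $m$ circles so produced. For $1\le k\le n$ let $E_k$ be the diagram with arrows $(k,k+1)$, $(k',(k+1)')$ and $(x,x')$ for $x\ne k,k+1$. For a fully commutative $w$, let $\mathcal D(w)$ be the diagram equal to the product $E_{k_1}\cdots E_{k_\ell}$ for every reduced expression $\sigma_{k_1}\cdots\sigma_{k_\ell}$ of $w$ (no circle occurs in this product, and it does not depend on the reduced expression). Proposition. Let $D$ be a non-crossing diagram on $n+1$ strings, of size $p$. Then $\mathcal I(D)$ and $\mathcal J(D)$ both have $p$ elements; write them in decreasing order as $i_1>\dots>i_p$ and $j_1>\dots>j_p$. Then $1\le i_k\le j_k\le n$ for every $k$, the expression $$w_D=[i_1,j_1][i_2,j_2]\cdots[i_p,j_p]$$ is reduced, the element $w_D$ is fully commutative, $\mathcal D(w_D)=D$, and $w_D$ is the only fully commutative element $w$ of $W(A_n)$ with $\mathcal D(w)=D$; that is, $w_D=\mathcal D^{-1}(D)$. In particular $\mathcal I(D)$ and $\mathcal J(D)$ determine $D$: if $D'$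 is a non-crossing diagram on $n+1$ strings with $\mathcal I(D')=\mathcal I(D)$ and $\mathcal J(D')=\mathcal J(D)$, then $D'=D$. -/

import Mathlib

/-! Dots are numbered `1, …, n + 1` on each line; the dot with number `x + 1` is represented by
`x : Fin (n + 1)`.  The generator `σ_{k + 1}` of `W(A_n)` is represented by `k : Fin n`. -/

namespace FCDiagram

/-- The `2(n+1)` dots, in two rows, with the total order
`1 < 2 < ⋯ < n+1 < 1' < 2' < ⋯ < (n+1)'`. -/
abbrev Dot (n : ℕ) : Type := Fin (n + 1) ⊕ₗ Fin (n + 1)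

/-- A dot of the top line `A`. -/
abbrev top {n : ℕ} (x : Fin (n + 1)) : Dot n := Sum.inlₗ x

/-- A dot `x'` of the bottom line `B`. -/
abbrev bot {n : ℕ} (x : Fin (n + 1)) : Dot n := Sum.inrₗ x

/-- Position of a dot when one walks along the boundary of the rectangle: the top line from left
to right, then the bottom line from right to left. -/
def boundaryPos {n : ℕ} (d : Dot n) : ℕ :=
  Sum.elim (fun x : Fin (n + 1) => (x : ℕ)) (fun x : Fin (n + 1) => 2 * n + 1 - (x : ℕ)) (ofLex d)

/-- `u` and `v` are the two endpoints of an arrow of `D`. -/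
def Joined {n : ℕ} (D : Set (Dot n × Dot n)) (u v : Dot n) : Prop :=
  (u, v) ∈ D ∨ (v, u) ∈ D

/-- A non-crossing diagram on `n + 1` strings, as a set of arrows `(x, y)` with `x < y`.
Two joins can be drawn in the rectangle without intersecting exactly when their endpoints
do not alternate along its boundary. -/
structure IsNonCrossingDiagram {n : ℕ} (D : Set (Dot n × Dot n)) : Prop where
  lt : ∀ a ∈ D, a.1 < a.2
  existsUnique : ∀ d : Dot n, ∃! a : Dot n × Dot n, a ∈ D ∧ (a.1 = d ∨ a.2 = d)
  nonCrossing : ∀ u s v t : Dot n, boundaryPos u < boundaryPos s → boundaryPos s < boundaryPos v →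
    boundaryPos v < boundaryPos t → ¬ (Joined D u v ∧ Joined D s t)

/-- Arrows in the top row. -/
def topArrows {n : ℕ} (D : Set (Dot n × Dot n)) : Set (Dot n × Dot n) :=
  {a ∈ D | ∃ x y : Fin (n + 1), a = (top x, top y)}

/-- Arrows in the bottom row. -/
def botArrows {n : ℕ} (D : Set (Dot n × Dot n)) : Set (Dot n × Dot n) :=
  {a ∈ D | ∃ x y : Fin (n + 1), a = (bot x, bot y)}

/-- Positive arrows from the top row to the bottom row: `(x, y)` with `x' < y`. -/
def posArrows {n : ℕ} (D : Set (Dot n × Dot n)) : Set (Dot n × Dot n) :=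
  {a ∈ D | ∃ x y : Fin (n + 1), a = (top x, bot y) ∧ bot x < (bot y : Dot n)}

/-- `𝓘(D)`, the set of numbers of the tails of the arrows in `AD ∪ D⁺`. -/
def tailSet {n : ℕ} (D : Set (Dot n × Dot n)) : Set ℕ :=
  {i | ∃ (x : Fin (n + 1)) (y : Dot n),
    i = (x : ℕ) + 1 ∧ (top x, y) ∈ topArrows D ∪ posArrows D}

/-- `𝓙(D)`, the set of the `j` in `{1, …, n+1}` such that `(j+1)'` is the head of an arrow in
`BD ∪ D⁺`. -/
def headSet {n : ℕ} (D : Set (Dot n × Dot n)) : Set ℕ :=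
  {j | 1 ≤ j ∧ j ≤ n + 1 ∧ ∃ (x : Dot n) (y : Fin (n + 1)),
    j + 1 = (y : ℕ) + 1 ∧ (x, bot y) ∈ botArrows D ∪ posArrows D}

/-- The size of `D`. -/
noncomputable def size {n : ℕ} (D : Set (Dot n × Dot n)) : ℕ :=
  (topArrows D ∪ posArrows D).ncard

/-! ### Concatenation -/

/-- A row (`0` is the highest) and a place in it, for three rows of `n + 1` dots. -/
abbrev StackDot (n : ℕ) : Type := Fin 3 × Fin (n + 1)

/-- Places the two rows of a diagram on the rows `r` and `r'` of the stack. -/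
def place {n : ℕ} (r r' : Fin 3) (d : Dot n) : StackDot n :=
  Sum.elim (fun x : Fin (n + 1) => (r, x)) (fun x : Fin (n + 1) => (r', x)) (ofLex d)

/-- The graph drawn when `D₂` is placed below `D₁`, the bottom line of `D₁` being glued to the
top line of `D₂`. -/
def stackGraph {n : ℕ} (D₁ D₂ : Set (Dot n × Dot n)) : SimpleGraph (StackDot n) :=
  SimpleGraph.fromRel fun u v =>
    (∃ a ∈ D₁, u = place 0 1 a.1 ∧ v = place 0 1 a.2) ∨
    (∃ a ∈ D₂, u = place 1 2 a.1 ∧ v = place 1 2 a.2)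

/-- The concatenation `D₁ ∗ D₂`, circles being deleted. -/
def concat {n : ℕ} (D₁ D₂ : Set (Dot n × Dot n)) : Set (Dot n × Dot n) :=
  {a | a.1 < a.2 ∧ (stackGraph D₁ D₂).Reachable (place 0 2 a.1) (place 0 2 a.2)}

/-- The number `m(D₁, D₂)` of circles deleted in `D₁ ∗ D₂`: they are the connected components
all of whose dots lie in the middle row. -/
noncomputable def circles {n : ℕ} (D₁ D₂ : Set (Dot n × Dot n)) : ℕ :=
  {c : (stackGraph D₁ D₂).ConnectedComponent | ∀ v ∈ c.supp, v.1 = 1}.ncard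

/-- The diagram with arrows `(x, x')`. -/
def idDiagram (n : ℕ) : Set (Dot n × Dot n) :=
  {a | ∃ x : Fin (n + 1), a = (top x, bot x)}

/-- The diagram `E_{k+1}`. -/
def genDiagram {n : ℕ} (k : Fin n) : Set (Dot n × Dot n) :=
  {(top k.castSucc, top k.succ), (bot k.castSucc, bot k.succ)} ∪
    {a | ∃ x : Fin (n + 1), x ≠ k.castSucc ∧ x ≠ k.succ ∧ a = (top x, bot x)}

/-- The product of the diagrams `E` along a word, in the diagram algebra with multiplication
`D₁ D₂ = δ ^ m(D₁, D₂) • (D₁ ∗ D₂)`; the pair `(m, D)` stands for `δ ^ m • D`. -/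
noncomputable def monomial {n : ℕ} (ω : List (Fin n)) : ℕ × Set (Dot n × Dot n) :=
  ω.foldl (fun P k => (P.1 + circles P.2 (genDiagram k), concat P.2 (genDiagram k)))
    (0, idDiagram n)

/-! ### Fully commutative elements -/

/-- `ω'` is obtained from `ω` by one commutation relation `s t = t s` with `m_{st} = 2`. -/
def CommStep {B : Type*} (M : CoxeterMatrix B) (ω ω' : List B) : Prop :=
  ∃ (l r : List B) (s t : B), M s t = 2 ∧ ω = l ++ [s, t] ++ r ∧ ω' = l ++ [t, s] ++ r

/-- One can pass from any reduced expression of `w` to any other by commutation relations. -/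
def IsFullyCommutative {B W : Type*} [Group W] {M : CoxeterMatrix B} (cs : CoxeterSystem M W)
    (w : W) : Prop :=
  ∀ ω ω' : List B, cs.IsReduced ω → cs.IsReduced ω' → cs.wordProd ω = w → cs.wordProd ω' = w →
    Relation.ReflTransGen (CommStep M) ω ω'

/-- The Coxeter group `W(A_n)` with its generators. -/
abbrev cox (n : ℕ) : CoxeterSystem (CoxeterMatrix.A n) (CoxeterMatrix.A n).Group :=
  (CoxeterMatrix.A n).toCoxeterSystem

/-- The word `σ_i σ_{i+1} ⋯ σ_j`, for `1 ≤ i ≤ j ≤ n`. -/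
def block (n i j : ℕ) : List (Fin n) :=
  (List.finRange n).filter fun k => i ≤ (k : ℕ) + 1 ∧ (k : ℕ) + 1 ≤ j

/-- The word `[i₁, j₁] [i₂, j₂] ⋯ [i_p, j_p]`. -/
def pairsWord (n : ℕ) {p : ℕ} (i j : Fin p → ℕ) : List (Fin n) :=
  (List.ofFn fun k => block n (i k) (j k)).flatten

/-- `D = 𝓓(w)`: the monomial `e_w`, formed along any reduced expression of `w`, is sent to the
basis element `D` of the diagram algebra when each `e_k` is sent to `E_k`. -/
def IsDiagramOf {n : ℕ} (w : (CoxeterMatrix.A n).Group) (D : Set (Dot n × Dot n)) : Prop :=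
  ∀ ω : List (Fin n), (cox n).IsReduced ω → (cox n).wordProd ω = w → monomial ω = (0, D)

end FCDiagram

/-!
Walking along the boundary of the rectangle, a diagram becomes an involution of `ℤ`: the dot `x`
is sent to `-x` and the dot `y'` to `y`. Multiplying by `E_k` reconnects the partners of `k` and
`k + 1`, and a circle appears only when `k` and `k + 1` are already joined. A word which is
shortest among those with a given involution therefore contains no `σ_k σ_k` and no
`σ_k σ_l σ_k`, even after commutations, and commutations bring it to the form
`[i₁, j₁] ⋯ [i_p, j_p]` with decreasing `i`'s and `j`'s. Appending a block `[i, j]` adds exactly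
the tail `i` and the head `j + 1`, so the involution determines such a form; hence every word of
this form is shortest, reduced and free of circles. Removing a cup that joins two neighbours shows
that every non-crossing diagram comes from a word.
-/


namespace FCDiagram

open Relation

section Coxeter

variable {B W : Type*} [Group W] {M : CoxeterMatrix B} (cs : CoxeterSystem M W)

/-! ### The exchange property -/

open Classical in
/-- The action of a simple reflection on signed group elements: conjugation, with a change of sign
at the simple reflection itself. It extends to the group, and the sign then records the parity of
the number of times a reflection occurs in the inversion sequence of a word. -/
noncomputable def signedConj (i : B) : Function.End (W × ZMod 2) := fun p =>
  (cs.simple i * p.1 * cs.simple i, p.2 + if p.1 = cs.simple i then 1 else 0)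

open Classical in
theorem prod_map_signedConj (ω : List B) (p : W × ZMod 2) :
    (ω.map (signedConj cs)).prod p =
      (cs.wordProd ω * p.1 * (cs.wordProd ω)⁻¹, p.2 + (cs.rightInvSeq ω).count p.1) := by
  induction ω with
  | nil => simp [Function.End.one_def]
  | cons i ω ih =>
    have conj_eq_iff : cs.wordProd ω * p.1 * (cs.wordProd ω)⁻¹ = cs.simple i ↔
        (cs.wordProd ω)⁻¹ * cs.simple i * cs.wordProd ω = p.1 := by
      rw [mul_inv_eq_iff_eq_mul, ← eq_inv_mul_iff_mul_eq, eq_comm, mul_assoc]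
    change signedConj cs i ((ω.map (signedConj cs)).prod p) = _
    rw [ih]
    simp only [signedConj, conj_eq_iff, CoxeterSystem.rightInvSeq, List.count_cons, beq_iff_eq]
    simp only [CoxeterSystem.wordProd_cons, mul_inv_rev, CoxeterSystem.inv_simple, mul_assoc,
      Nat.cast_add, Nat.cast_ite, Nat.cast_one, Nat.cast_zero, add_assoc]

theorem prod_map_reverse_alternatingWord {N : Type*} [Monoid N] (f : B → N) (i j : B) (p : ℕ) :
    ((CoxeterSystem.alternatingWord i j (2 * p)).reverse.map f).prod = (f j * f i) ^ p := by
  induction p with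
  | zero => simp [CoxeterSystem.alternatingWord]
  | succ p ih =>
    rw [mul_add_one, CoxeterSystem.alternatingWord_succ, CoxeterSystem.alternatingWord_succ]
    simp only [List.concat_eq_append, List.reverse_append, List.reverse_singleton,
      List.singleton_append, List.map_cons, List.prod_cons, ih, pow_succ', mul_assoc]

open Classical in
theorem even_count_rightInvSeq_reverse_alternatingWord (i j : B) (t : W) :
    Even ((cs.rightInvSeq (CoxeterSystem.alternatingWord i j (2 * M i j)).reverse).count t) := by
  set reflection : ℕ → W := fun k => cs.wordProd (CoxeterSystem.alternatingWord j i (2 * k + 1))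
  have periodic : ∀ k, reflection (M i j + k) = reflection k := fun k => by
    simp [reflection, CoxeterSystem.prod_alternatingWord_eq_mul_pow,
      Nat.mul_add_div, pow_add, M.symmetric i j]
  have invSeq_eq : cs.leftInvSeq (CoxeterSystem.alternatingWord i j (2 * M i j)) =
      (List.range (M i j + M i j)).map reflection := by
    refine List.ext_getElem (by simp [two_mul]) fun k hk _ => ?_
    rw [cs.getElem_leftInvSeq_alternatingWord i j (M i j) k (by simpa using hk)]
    simp [reflection]
  rw [CoxeterSystem.rightInvSeq_reverse, List.count_reverse, invSeq_eq, List.range_add,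
    List.map_append, List.map_map, List.count_append]
  simp only [Function.comp_def, periodic]
  exact ⟨_, rfl⟩

theorem isLiftable_signedConj : M.IsLiftable (signedConj cs) := by
  classical
  intro i j
  funext p
  obtain ⟨c, hc⟩ := even_count_rightInvSeq_reverse_alternatingWord cs j i p.1
  rw [← prod_map_reverse_alternatingWord, M.symmetric i j, prod_map_signedConj, hc,
    CoxeterSystem.wordProd, prod_map_reverse_alternatingWord, M.symmetric j i,
    cs.simple_mul_simple_pow]
  simp [Function.End.one_def, CharTwo.add_self_eq_zero]

/-- The action of a Coxeter group on signed elements that extends `signedConj`. -/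
noncomputable def signedConjHom : W →* Function.End (W × ZMod 2) :=
  cs.lift ⟨signedConj cs, isLiftable_signedConj cs⟩

open Classical in
theorem signedConjHom_wordProd (ω : List B) (p : W × ZMod 2) :
    signedConjHom cs (cs.wordProd ω) p =
      (cs.wordProd ω * p.1 * (cs.wordProd ω)⁻¹, p.2 + (cs.rightInvSeq ω).count p.1) := by
  rw [← prod_map_signedConj, CoxeterSystem.wordProd, map_list_prod, List.map_map]
  have comp_simple : signedConjHom cs ∘ cs.simple = signedConj cs :=
    funext fun i => cs.lift_apply_simple _ i
  rw [comp_simple]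

open Classical in
theorem natCast_count_rightInvSeq_eq {ω ω' : List B} (h : cs.wordProd ω = cs.wordProd ω') (t : W) :
    ((cs.rightInvSeq ω).count t : ZMod 2) = (cs.rightInvSeq ω').count t := by
  simpa [signedConjHom_wordProd] using
    congrArg (fun w => (signedConjHom cs w (t, 0)).2) h

theorem exists_eraseIdx_of_isRightDescent {ω : List B} {i : B}
    (h : cs.IsRightDescent (cs.wordProd ω) i) :
    ∃ k < ω.length, cs.wordProd ω * cs.simple i = cs.wordProd (ω.eraseIdx k) := by
  classical
  obtain ⟨ω', hω', hprod⟩ := cs.exists_isReduced (cs.wordProd ω * cs.simple i)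
  have prod_concat : cs.wordProd (ω'.concat i) = cs.wordProd ω := by
    rw [CoxeterSystem.wordProd_concat, ← hprod, cs.simple_mul_simple_cancel_right]
  have reduced_concat : cs.IsReduced (ω'.concat i) := by
    rw [CoxeterSystem.IsReduced, prod_concat, ← cs.isRightDescent_iff.1 h, hprod, hω',
      List.length_concat]
  have count_concat : (cs.rightInvSeq (ω'.concat i)).count (cs.simple i) = 1 :=
    List.count_eq_one_of_mem reduced_concat.nodup_rightInvSeq
      (by rw [CoxeterSystem.rightInvSeq_concat]; simp)
  have mem_invSeq : cs.simple i ∈ cs.rightInvSeq ω := by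
    by_contra hmem
    have parity_eq := natCast_count_rightInvSeq_eq cs prod_concat (cs.simple i)
    rw [count_concat, List.count_eq_zero_of_not_mem hmem] at parity_eq
    exact one_ne_zero (by exact_mod_cast parity_eq)
  obtain ⟨k, hk, hget⟩ := List.mem_iff_getElem.1 mem_invSeq
  refine ⟨k, by simpa using hk, ?_⟩
  rw [← cs.wordProd_mul_getD_rightInvSeq, List.getD_eq_getElem _ _ hk, hget]

/-! ### Commutation classes -/

/-- `ω'` is obtained from `ω` by finitely many commutation relations. -/
abbrev CommEquiv (M : CoxeterMatrix B) : List B → List B → Prop := ReflTransGen (CommStep M)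

/-- `ω'` is obtained from `ω` by one relation `s t s = t s t` with `m_{st} = 3`. -/
def BraidStep (M : CoxeterMatrix B) (ω ω' : List B) : Prop :=
  ∃ (l r : List B) (s t : B), M s t = 3 ∧ ω = l ++ [s, t, s] ++ r ∧ ω' = l ++ [t, s, t] ++ r

/-- No word of the commutation class of `ω` has a factor `s s`, or a factor `s t s` with
`m_{st} = 3`. In the simply laced case these are the reduced words of the fully commutative
elements, described without mentioning the group. -/
def IsBraidFree (M : CoxeterMatrix B) (ω : List B) : Prop :=
  ∀ ω', CommEquiv M ω ω' →
    (∀ s, ¬ [s, s] <:+: ω') ∧ ∀ s t, M s t = 3 → ¬ [s, t, s] <:+: ω'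

theorem CommStep.symm {ω ω' : List B} (h : CommStep M ω ω') : CommStep M ω' ω := by
  obtain ⟨l, r, s, t, hst, rfl, rfl⟩ := h
  exact ⟨l, r, t, s, M.symmetric t s ▸ hst, rfl, rfl⟩

theorem CommEquiv.symm {ω ω' : List B} (h : CommEquiv M ω ω') : CommEquiv M ω' ω := by
  induction h with
  | refl => exact .refl
  | tail _ hstep ih => exact .head hstep.symm ih

theorem CommStep.append {ω ω' : List B} (h : CommStep M ω ω') (a b : List B) :
    CommStep M (a ++ ω ++ b) (a ++ ω' ++ b) := by
  obtain ⟨l, r, s, t, hst, rfl, rfl⟩ := h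
  exact ⟨a ++ l, r ++ b, s, t, hst, by simp, by simp⟩

theorem CommEquiv.append {ω ω' : List B} (h : CommEquiv M ω ω') (a b : List B) :
    CommEquiv M (a ++ ω ++ b) (a ++ ω' ++ b) :=
  h.lift (fun η => a ++ η ++ b) fun _ _ hstep => hstep.append a b

theorem commEquiv_append_singleton {ω : List B} {s : B} (h : ∀ t ∈ ω, M s t = 2) :
    CommEquiv M (ω ++ [s]) (s :: ω) := by
  induction ω with
  | nil => exact .refl
  | cons t ω ih =>
    have past_ω := CommEquiv.append (ih fun u hu => h u (List.mem_cons_of_mem t hu)) [t] []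
    rw [List.append_nil, List.append_nil] at past_ω
    exact .tail past_ω ⟨[], ω, t, s, M.symmetric s t ▸ h t List.mem_cons_self,
      by simp, by simp⟩

theorem CommStep.perm {ω ω' : List B} (h : CommStep M ω ω') : ω.Perm ω' := by
  obtain ⟨l, r, s, t, -, rfl, rfl⟩ := h
  exact ((List.Perm.swap t s []).append_left l).append_right r

theorem CommEquiv.perm {ω ω' : List B} (h : CommEquiv M ω ω') : ω.Perm ω' := by
  induction h with
  | refl => exact .refl _
  | tail _ hstep ih => exact ih.trans hstep.perm

theorem simple_mul_simple_comm {s t : B} (h : M s t = 2) :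
    cs.simple s * cs.simple t = cs.simple t * cs.simple s := by
  simpa [CoxeterSystem.braidWord, M.symmetric t s, h, CoxeterSystem.alternatingWord,
    CoxeterSystem.wordProd] using cs.wordProd_braidWord_eq s t

theorem simple_mul_simple_mul_simple {s t : B} (h : M s t = 3) :
    cs.simple s * cs.simple t * cs.simple s = cs.simple t * cs.simple s * cs.simple t := by
  simpa [CoxeterSystem.braidWord, M.symmetric t s, h, CoxeterSystem.alternatingWord,
    CoxeterSystem.wordProd, mul_assoc] using cs.wordProd_braidWord_eq t s

theorem CommStep.wordProd_eq {ω ω' : List B} (h : CommStep M ω ω') :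
    cs.wordProd ω = cs.wordProd ω' := by
  obtain ⟨l, r, s, t, hst, rfl, rfl⟩ := h
  simp only [CoxeterSystem.wordProd_append, CoxeterSystem.wordProd_cons,
    CoxeterSystem.wordProd_nil, mul_one, simple_mul_simple_comm cs hst]

theorem BraidStep.wordProd_eq {ω ω' : List B} (h : BraidStep M ω ω') :
    cs.wordProd ω = cs.wordProd ω' := by
  obtain ⟨l, r, s, t, hst, rfl, rfl⟩ := h
  simp only [CoxeterSystem.wordProd_append, CoxeterSystem.wordProd_cons,
    CoxeterSystem.wordProd_nil, mul_one, ← mul_assoc (cs.simple s), ← mul_assoc (cs.simple t),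
    simple_mul_simple_mul_simple cs hst]

theorem CommEquiv.wordProd_eq {ω ω' : List B} (h : CommEquiv M ω ω') :
    cs.wordProd ω = cs.wordProd ω' := by
  induction h with
  | refl => rfl
  | tail _ hstep ih => exact ih.trans (hstep.wordProd_eq cs)

theorem CommEquiv.isReduced {ω ω' : List B} (h : CommEquiv M ω ω') (hω : cs.IsReduced ω) :
    cs.IsReduced ω' := by
  rw [CoxeterSystem.IsReduced, ← h.wordProd_eq cs, hω, h.perm.length_eq]

theorem IsBraidFree.of_append {ω ω' : List B} (h : IsBraidFree M (ω ++ ω')) :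
    IsBraidFree M ω := by
  intro η hη
  obtain ⟨no_square, no_braid⟩ := h (η ++ ω') (by simpa using CommEquiv.append hη [] ω')
  have infix_append : η <:+: η ++ ω' := (List.prefix_append _ _).isInfix
  exact ⟨fun s hs => no_square s (hs.trans infix_append),
    fun s t hst hs => no_braid s t hst (hs.trans infix_append)⟩

/-! ### Reduced words in simply laced Coxeter groups -/

/-- All entries of the Coxeter matrix outside the diagonal are `2` or `3`. -/
def IsSimplyLaced (M : CoxeterMatrix B) : Prop :=
  ∀ s t, s ≠ t → M s t = 2 ∨ M s t = 3

theorem isReduced_of_length_le {ω : List B} {w : W} (hw : cs.wordProd ω = w)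
    (h : ω.length ≤ cs.length w) : cs.IsReduced ω := by
  subst hw
  exact le_antisymm (cs.length_wordProd_le ω) h

theorem isReduced_of_isReduced_append {ω ω' : List B} (h : cs.IsReduced (ω ++ ω')) :
    cs.IsReduced ω := by
  simpa using h.take ω.length

theorem wordProd_append_singleton (ω : List B) (s : B) :
    cs.wordProd (ω ++ [s]) = cs.wordProd ω * cs.simple s := by
  rw [cs.wordProd_append, cs.wordProd_singleton]

theorem isRightDescent_of_isReduced_append_singleton {ω : List B} {s : B}
    (h : cs.IsReduced (ω ++ [s])) : cs.IsRightDescent (cs.wordProd (ω ++ [s])) s := by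
  rw [cs.isRightDescent_iff, h.eq, wordProd_append_singleton, cs.simple_mul_simple_cancel_right,
    (isReduced_of_isReduced_append cs h).eq, List.length_append, List.length_singleton]

theorem length_mul_simple_mul_simple_add_two (hinj : Function.Injective cs.simple) {w : W}
    {s t : B} (hst : s ≠ t) (hs : cs.IsRightDescent w s) (ht : cs.IsRightDescent w t) :
    cs.length (w * cs.simple t * cs.simple s) + 2 = cs.length w := by
  obtain ⟨ω, hω, hprod⟩ := cs.exists_isReduced (w * cs.simple s)
  have prod_append : cs.wordProd (ω ++ [s]) = w := by
    rw [wordProd_append_singleton, ← hprod, cs.simple_mul_simple_cancel_right]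
  obtain ⟨k, hk, herase⟩ := exists_eraseIdx_of_isRightDescent cs (prod_append.symm ▸ ht)
  rw [prod_append] at herase
  have k_ne : k ≠ ω.length := by
    rintro rfl
    rw [List.eraseIdx_append_of_length_le le_rfl, Nat.sub_self, List.eraseIdx_zero, List.tail_cons,
      List.append_nil, ← hprod] at herase
    exact hst (hinj (mul_left_cancel herase)).symm
  have k_lt : k < ω.length := by
    rw [List.length_append, List.length_singleton] at hk
    omega
  rw [List.eraseIdx_append_of_lt_length k_lt, wordProd_append_singleton] at herase
  have length_le := cs.length_wordProd_le (ω.eraseIdx k)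
  have length_erase := List.length_eraseIdx_add_one k_lt
  have length_w := cs.isRightDescent_iff.1 hs
  rw [hprod, hω.eq] at length_w
  have length_wt := cs.isRightDescent_iff.1 ht
  have length_wts := cs.length_mul_simple (w * cs.simple t) s
  rw [herase, cs.simple_mul_simple_cancel_right] at length_wts ⊢
  rw [herase] at length_wt
  omega

theorem length_mul_braid_add_three (hinj : Function.Injective cs.simple) {w : W} {s t : B}
    (hst : M s t = 3) (hs : cs.IsRightDescent w s) (ht : cs.IsRightDescent w t) :
    cs.length (w * cs.simple s * cs.simple t * cs.simple s) + 3 = cs.length w := by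
  have hne : s ≠ t := fun h => by simp [h] at hst
  have braid : w * cs.simple t * cs.simple s * cs.simple t =
      w * cs.simple s * cs.simple t * cs.simple s := by
    simp only [mul_assoc] at *
    rw [← mul_assoc (cs.simple t), ← simple_mul_simple_mul_simple cs hst, mul_assoc]
  have length_wts := length_mul_simple_mul_simple_add_two cs hinj hne hs ht
  have length_wst := length_mul_simple_mul_simple_add_two cs hinj hne.symm ht hs
  have length_ws := cs.isRightDescent_iff.1 hs
  rcases cs.length_mul_simple (w * cs.simple s * cs.simple t) s with length_up | length_down
  · -- Otherwise `w s t s` would again have both descents.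
    have descent_s : cs.IsRightDescent (w * cs.simple s * cs.simple t * cs.simple s) s := by
      rw [cs.isRightDescent_iff, cs.simple_mul_simple_cancel_right, length_up]
    have descent_t : cs.IsRightDescent (w * cs.simple s * cs.simple t * cs.simple s) t := by
      rw [cs.isRightDescent_iff, length_up, ← braid, cs.simple_mul_simple_cancel_right]
      omega
    have length_two := length_mul_simple_mul_simple_add_two cs hinj hne.symm descent_t descent_s
    rw [cs.simple_mul_simple_cancel_right, cs.simple_mul_simple_cancel_right] at length_two
    omega
  · omega

theorem exists_step_of_isRightDescent (hM : IsSimplyLaced M) (hinj : Function.Injective cs.simple)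
    {w : W} {s t : B} (hst : s ≠ t) (hs : cs.IsRightDescent w s) (ht : cs.IsRightDescent w t) :
    ∃ η η', cs.IsReduced η ∧ cs.IsReduced η' ∧ cs.wordProd η = w * cs.simple s ∧
      cs.wordProd η' = w * cs.simple t ∧
      (CommStep M (η ++ [s]) (η' ++ [t]) ∨ BraidStep M (η ++ [s]) (η' ++ [t])) := by
  have length_ws := cs.isRightDescent_iff.1 hs
  have length_wt := cs.isRightDescent_iff.1 ht
  rcases hM s t hst with comm | braid
  · obtain ⟨ζ, hζ, hprod⟩ := cs.exists_isReduced (w * cs.simple t * cs.simple s)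
    have length_ζ := length_mul_simple_mul_simple_add_two cs hinj hst hs ht
    rw [hprod, hζ.eq] at length_ζ
    have prod_s : cs.wordProd (ζ ++ [t]) = w * cs.simple s := by
      rw [wordProd_append_singleton, ← hprod, mul_assoc w, ← simple_mul_simple_comm cs comm,
        ← mul_assoc, cs.simple_mul_simple_cancel_right]
    have prod_t : cs.wordProd (ζ ++ [s]) = w * cs.simple t := by
      rw [wordProd_append_singleton, ← hprod, cs.simple_mul_simple_cancel_right]
    refine ⟨ζ ++ [t], ζ ++ [s], isReduced_of_length_le cs prod_s ?_,
      isReduced_of_length_le cs prod_t ?_, prod_s, prod_t,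
      .inl ⟨ζ, [], t, s, M.symmetric s t ▸ comm, by simp, by simp⟩⟩ <;>
    · rw [List.length_append, List.length_singleton]
      omega
  · obtain ⟨ζ, hζ, hprod⟩ := cs.exists_isReduced (w * cs.simple s * cs.simple t * cs.simple s)
    have length_ζ := length_mul_braid_add_three cs hinj braid hs ht
    rw [hprod, hζ.eq] at length_ζ
    have prod_s : cs.wordProd (ζ ++ [s] ++ [t]) = w * cs.simple s := by
      rw [wordProd_append_singleton, wordProd_append_singleton, ← hprod,
        cs.simple_mul_simple_cancel_right, cs.simple_mul_simple_cancel_right]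
    have prod_t : cs.wordProd (ζ ++ [t] ++ [s]) = w * cs.simple t := by
      rw [wordProd_append_singleton, wordProd_append_singleton, ← hprod, mul_assoc w, mul_assoc w,
        simple_mul_simple_mul_simple cs braid, ← mul_assoc, ← mul_assoc,
        cs.simple_mul_simple_cancel_right, cs.simple_mul_simple_cancel_right]
    refine ⟨ζ ++ [s] ++ [t], ζ ++ [t] ++ [s], isReduced_of_length_le cs prod_s ?_,
      isReduced_of_length_le cs prod_t ?_, prod_s, prod_t,
      .inr ⟨ζ, [], s, t, braid, by simp, by simp⟩⟩ <;>
    · simp only [List.length_append, List.length_singleton]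
      omega

theorem reflTransGen_step_append {ω ω' : List B}
    (h : ReflTransGen (fun a b => CommStep M a b ∨ BraidStep M a b) ω ω') (s : B) :
    ReflTransGen (fun a b => CommStep M a b ∨ BraidStep M a b) (ω ++ [s]) (ω' ++ [s]) := by
  refine h.lift (· ++ [s]) ?_
  rintro _ _ (hstep | ⟨l, r, a, b, hab, rfl, rfl⟩)
  · exact .inl (by simpa using hstep.append [] [s])
  · exact .inr ⟨l, r ++ [s], a, b, hab, by simp, by simp⟩

/-- This is Matsumoto's theorem in the simply laced case. -/
theorem reflTransGen_step_of_wordProd_eq (hM : IsSimplyLaced M)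
    (hinj : Function.Injective cs.simple) {ω ω' : List B} (hω : cs.IsReduced ω)
    (hω' : cs.IsReduced ω') (h : cs.wordProd ω = cs.wordProd ω') :
    ReflTransGen (fun a b => CommStep M a b ∨ BraidStep M a b) ω ω' := by
  have length_eq : ω.length = ω'.length := by rw [← hω.eq, h, hω'.eq]
  induction hm : ω.length generalizing ω ω' with
  | zero =>
    rw [List.eq_nil_of_length_eq_zero hm, List.eq_nil_of_length_eq_zero (length_eq.symm.trans hm)]
  | succ m ih =>
    obtain ⟨ω, s, rfl⟩ := (List.eq_nil_or_concat' ω).resolve_left (by rintro rfl; simp at hm)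
    obtain ⟨ω', t, rfl⟩ := (List.eq_nil_or_concat' ω').resolve_left
      (by rintro rfl; simp [hm] at length_eq)
    have reduced_ω := isReduced_of_isReduced_append cs hω
    have reduced_ω' := isReduced_of_isReduced_append cs hω'
    have descent_s := isRightDescent_of_isReduced_append_singleton cs hω
    have descent_t := isRightDescent_of_isReduced_append_singleton cs hω'
    have cancel_last : ∀ (η : List B) (r : B),
        cs.wordProd (η ++ [r]) * cs.simple r = cs.wordProd η := fun η r => by
      rw [wordProd_append_singleton, cs.simple_mul_simple_cancel_right]
    have related : ∀ {η η' : List B} (r : B), η.length = m → cs.IsReduced η → cs.IsReduced η' →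
        cs.wordProd η = cs.wordProd η' →
        ReflTransGen (fun a b => CommStep M a b ∨ BraidStep M a b) (η ++ [r]) (η' ++ [r]) :=
      fun r hlen hη hη' heq => reflTransGen_step_append
        (ih hη hη' heq (by rw [← hη.eq, heq, hη'.eq]) hlen) r
    simp only [List.length_append, List.length_singleton, Nat.add_right_cancel_iff] at hm length_eq
    by_cases hst : s = t
    · subst hst
      exact related s hm reduced_ω reduced_ω' (by rw [← cancel_last ω s, h, cancel_last])
    obtain ⟨η, η', hη, hη', prod_η, prod_η', hstep⟩ :=
      exists_step_of_isRightDescent cs hM hinj hst descent_s (h ▸ descent_t)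
    rw [cancel_last] at prod_η
    rw [h, cancel_last] at prod_η'
    exact ((related s hm reduced_ω hη prod_η.symm).tail hstep).trans
      (related t (by rw [← hη'.eq, prod_η', reduced_ω'.eq, ← length_eq, hm]) hη' reduced_ω' prod_η')

theorem IsBraidFree.commEquiv (hM : IsSimplyLaced M) (hinj : Function.Injective cs.simple)
    {ω ω' : List B} (h : IsBraidFree M ω) (hω : cs.IsReduced ω) (hω' : cs.IsReduced ω')
    (hprod : cs.wordProd ω = cs.wordProd ω') : CommEquiv M ω ω' := by
  have steps := reflTransGen_step_of_wordProd_eq cs hM hinj hω hω' hprod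
  clear hω' hprod
  induction steps with
  | refl => exact .refl
  | tail _ hstep ih =>
    rcases hstep with hstep | ⟨l, r, s, t, hst, rfl, -⟩
    · exact ih.tail hstep
    · exact absurd ⟨l, r, rfl⟩ ((h _ ih).2 s t hst)

theorem IsBraidFree.isReduced (hM : IsSimplyLaced M) (hinj : Function.Injective cs.simple)
    {ω : List B} (h : IsBraidFree M ω) : cs.IsReduced ω := by
  induction ω using List.reverseRecOn with
  | nil => simp [CoxeterSystem.IsReduced]
  | append_singleton ω s ih =>
    have hω := ih h.of_append
    rcases cs.length_mul_simple (cs.wordProd ω) s with length_up | length_down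
    · rw [CoxeterSystem.IsReduced, wordProd_append_singleton, length_up, hω.eq,
        List.length_append, List.length_singleton]
    · exfalso
      obtain ⟨η, hη, hprod⟩ := cs.exists_isReduced (cs.wordProd ω * cs.simple s)
      have prod_η : cs.wordProd (η ++ [s]) = cs.wordProd ω := by
        rw [wordProd_append_singleton, ← hprod, cs.simple_mul_simple_cancel_right]
      have reduced_η : cs.IsReduced (η ++ [s]) := by
        refine isReduced_of_length_le cs prod_η ?_
        rw [← length_down, hprod, hη.eq, List.length_append, List.length_singleton]
      have hequiv := (h.of_append.commEquiv cs hM hinj hω reduced_η prod_η.symm).append [] [s]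
      exact (h _ hequiv).1 s ⟨η, [], by simp⟩

theorem IsBraidFree.isFullyCommutative (hM : IsSimplyLaced M) (hinj : Function.Injective cs.simple)
    {ω : List B} (h : IsBraidFree M ω) : IsFullyCommutative cs (cs.wordProd ω) := by
  intro ω₁ ω₂ hω₁ hω₂ hprod₁ hprod₂
  have hω := h.isReduced cs hM hinj
  exact (h.commEquiv cs hM hinj hω hω₁ hprod₁.symm).symm.trans
    (h.commEquiv cs hM hinj hω hω₂ hprod₂.symm)

theorem IsFullyCommutative.isBraidFree {ω : List B}
    (h : IsFullyCommutative cs (cs.wordProd ω)) (hω : cs.IsReduced ω) : IsBraidFree M ω := by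
  classical
  intro ω' hequiv
  have hω' := hequiv.isReduced cs hω
  have hprod := hequiv.wordProd_eq cs
  constructor
  · rintro s ⟨l, r, rfl⟩
    have prod_erase : cs.wordProd (l ++ [s, s] ++ r) = cs.wordProd (l ++ r) := by
      simp [CoxeterSystem.wordProd_append, CoxeterSystem.wordProd_cons]
    have length_le := cs.length_wordProd_le (l ++ r)
    rw [← prod_erase, hω'.eq] at length_le
    simp only [List.length_append, List.length_cons, List.length_nil] at length_le
    omega
  · rintro s t hst ⟨l, r, rfl⟩
    have prod_braid := BraidStep.wordProd_eq cs ⟨l, r, s, t, hst, rfl, rfl⟩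
    have reduced_braid : cs.IsReduced (l ++ [t, s, t] ++ r) :=
      isReduced_of_length_le cs prod_braid.symm (by rw [hω'.eq]; simp)
    -- The two sides of a braid relation do not have the same letters.
    have count_eq := (CommEquiv.perm
      (h _ _ hω' reduced_braid hprod.symm (prod_braid.symm.trans hprod.symm))).count_eq s
    have hne : t ≠ s := fun hts => by simp [hts] at hst
    simp [hne] at count_eq

end Coxeter

section TypeA

variable {n : ℕ}

/-! ### Words in type `A` -/

theorem typeA_apply (s t : Fin n) : CoxeterMatrix.A n s t =
    if s = t then 1 else if (t : ℕ) + 1 = s ∨ (s : ℕ) + 1 = t then 3 else 2 := rfl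

theorem typeA_eq_two_iff (s t : Fin n) :
    CoxeterMatrix.A n s t = 2 ↔ (s : ℕ) ≠ t ∧ (s : ℕ) + 1 ≠ t ∧ (t : ℕ) + 1 ≠ s := by
  rw [typeA_apply]
  split_ifs with h <;> rw [Fin.ext_iff] at h <;> omega

theorem typeA_eq_three_iff (s t : Fin n) :
    CoxeterMatrix.A n s t = 3 ↔ (s : ℕ) + 1 = t ∨ (t : ℕ) + 1 = s := by
  rw [typeA_apply]
  split_ifs with h <;> rw [Fin.ext_iff] at h <;> omega

theorem isSimplyLaced_typeA : IsSimplyLaced (CoxeterMatrix.A n) := by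
  intro s t hst
  rw [typeA_eq_two_iff, typeA_eq_three_iff]
  rw [Ne, Fin.ext_iff] at hst
  omega

theorem swap_mul_swap_pow_three {α : Type*} [DecidableEq α] {a b c : α} (hab : a ≠ b)
    (hbc : b ≠ c) (hac : a ≠ c) : (Equiv.swap a b * Equiv.swap b c) ^ 3 = 1 := by
  have left := Equiv.swap_mul_swap_mul_swap hbc.symm hac.symm
  have right := Equiv.swap_mul_swap_mul_swap hab hac
  rw [Equiv.swap_comm b a, Equiv.swap_comm c b] at left
  rw [Equiv.swap_comm c a] at right
  calc (Equiv.swap a b * Equiv.swap b c) ^ 3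
      = (Equiv.swap a b * Equiv.swap b c * Equiv.swap a b) *
          (Equiv.swap b c * Equiv.swap a b * Equiv.swap b c) := by
        simp only [pow_succ, pow_zero, one_mul, mul_assoc]
    _ = 1 := by rw [left, right, Equiv.swap_mul_self]

theorem isLiftable_swap :
    (CoxeterMatrix.A n).IsLiftable fun i : Fin n => Equiv.swap (i : ℕ) (i + 1) := by
  intro i j
  rcases eq_or_ne i j with rfl | hij
  · simp
  rcases isSimplyLaced_typeA i j hij with h | h <;> rw [h]
  · rw [typeA_eq_two_iff] at h
    have disjoint : (Equiv.swap (i : ℕ) (i + 1)).Disjoint (Equiv.swap (j : ℕ) (j + 1)) := by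
      intro x
      rw [Equiv.swap_apply_def, Equiv.swap_apply_def]
      split_ifs <;> omega
    rw [disjoint.commute.mul_pow, sq, sq, Equiv.swap_mul_self, Equiv.swap_mul_self, one_mul]
  · rw [typeA_eq_three_iff] at h
    rcases h with h | h
    · simp only [← h]
      exact swap_mul_swap_pow_three (by omega) (by omega) (by omega)
    · simp only [← h]
      rw [Equiv.swap_comm, Equiv.swap_comm (j : ℕ)]
      exact swap_mul_swap_pow_three (by omega) (by omega) (by omega)

theorem cox_simple_injective : Function.Injective (cox n).simple := by
  intro i j hij
  have swap_eq := congrArg ((cox n).lift ⟨_, isLiftable_swap⟩) hij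
  rw [CoxeterSystem.lift_apply_simple, CoxeterSystem.lift_apply_simple] at swap_eq
  have apply_eq : (i : ℕ) + 1 = Equiv.swap (j : ℕ) (j + 1) i := by
    rw [← swap_eq, Equiv.swap_apply_left]
  rw [Equiv.swap_apply_def] at apply_eq
  apply Fin.ext
  split_ifs at apply_eq <;> omega

theorem mem_block {i j : ℕ} {s : Fin n} : s ∈ block n i j ↔ i ≤ (s : ℕ) + 1 ∧ (s : ℕ) + 1 ≤ j := by
  simp [block]

theorem pairwise_block (i j : ℕ) : (block n i j).Pairwise (· < ·) :=
  (List.pairwise_lt_finRange n).filter _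

theorem eq_block {i j : ℕ} {l : List (Fin n)} (hl : l.Pairwise (· < ·))
    (hmem : ∀ s : Fin n, s ∈ l ↔ i ≤ (s : ℕ) + 1 ∧ (s : ℕ) + 1 ≤ j) : block n i j = l :=
  (pairwise_block i j).eq_of_mem_iff hl fun s => mem_block.trans (hmem s).symm

theorem block_append {i k j : ℕ} (hik : i ≤ k + 1) (hkj : k ≤ j) :
    block n i j = block n i k ++ block n (k + 1) j := by
  refine eq_block (List.pairwise_append.2
    ⟨pairwise_block _ _, pairwise_block _ _, fun a ha b hb => ?_⟩) fun s => ?_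
  · rw [mem_block] at ha hb
    rw [Fin.lt_def]
    omega
  · rw [List.mem_append, mem_block, mem_block]
    omega

theorem block_self (s : Fin n) : block n (s + 1) (s + 1) = [s] := by
  refine eq_block (List.pairwise_singleton _ _) fun t => ?_
  rw [List.mem_singleton, Fin.ext_iff]
  omega

theorem block_succ_right {i : ℕ} (s : Fin n) (h : i ≤ s + 1) :
    block n i (s + 1) = block n i s ++ [s] := by
  rw [block_append h (Nat.le_succ _), block_self]

theorem block_succ_left {j : ℕ} (s : Fin n) (h : s + 1 ≤ j) :
    block n (s + 1) j = s :: block n (s + 2) j := by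
  rw [block_append (k := s + 1) (by omega) h, block_self, List.singleton_append]

theorem commEquiv_block_append_singleton {i j : ℕ} {s : Fin n} (h : j < s ∨ (s : ℕ) + 2 < i) :
    CommEquiv (CoxeterMatrix.A n) (block n i j ++ [s]) (s :: block n i j) :=
  commEquiv_append_singleton fun t ht => by
    rw [mem_block] at ht
    rw [typeA_eq_two_iff]
    omega

/-! ### Normal words -/

/-- Lists of pairs `(i, j)` with `1 ≤ i ≤ j ≤ n`, strictly decreasing in both components: the
data that determine the expressions `[i₁, j₁] ⋯ [i_p, j_p]` of the proposition. -/
def IsNormal (n : ℕ) (L : List (ℕ × ℕ)) : Prop :=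
  L.Pairwise (fun a b => b.1 < a.1 ∧ b.2 < a.2) ∧ ∀ q ∈ L, 1 ≤ q.1 ∧ q.1 ≤ q.2 ∧ q.2 ≤ n

/-- The word `[i₁, j₁] ⋯ [i_p, j_p]` of the list of pairs `(i₁, j₁), …, (i_p, j_p)`. -/
def normalWord (n : ℕ) (L : List (ℕ × ℕ)) : List (Fin n) :=
  L.flatMap fun q => block n q.1 q.2

theorem normalWord_append_singleton (L : List (ℕ × ℕ)) (q : ℕ × ℕ) :
    normalWord n (L ++ [q]) = normalWord n L ++ block n q.1 q.2 := by
  simp [normalWord]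

theorem isNormal_append_singleton {L : List (ℕ × ℕ)} {q : ℕ × ℕ} :
    IsNormal n (L ++ [q]) ↔ IsNormal n L ∧ (∀ r ∈ L, q.1 < r.1 ∧ q.2 < r.2) ∧
      1 ≤ q.1 ∧ q.1 ≤ q.2 ∧ q.2 ≤ n := by
  simp only [IsNormal, List.pairwise_append, List.forall_mem_append, List.forall_mem_singleton,
    List.pairwise_singleton, true_and]
  tauto

theorem not_isBraidFree_block_append_singleton (l : List (Fin n)) {i j : ℕ} {s : Fin n}
    (hi : i ≤ s + 1) (hs : s + 1 ≤ j) (hj : j ≤ n) :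
    ¬ IsBraidFree (CoxeterMatrix.A n) (l ++ block n i j ++ [s]) := by
  intro h
  rw [block_append (k := s + 1) (by omega) hs, block_succ_right s hi] at h
  rcases hs.eq_or_lt with rfl | hlt
  · have no_letter : block n (s + 1 + 1) (s + 1) = [] := by simp [block]
    exact (h _ .refl).1 s ⟨l ++ block n i s, [], by simp [no_letter]⟩
  · let t : Fin n := ⟨s + 1, by omega⟩
    have split : block n (s + 1 + 1) j = t :: block n (s + 3) j := block_succ_left t hlt
    have hequiv := (commEquiv_block_append_singleton (i := s + 3) (j := j) (s := s)
      (.inr (by omega))).append (l ++ block n i s ++ [s, t]) []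
    refine (h _ (by simpa [split] using hequiv)).2 s t ((typeA_eq_three_iff s t).2 (.inl rfl))
      ⟨l ++ block n i s, block n (s + 3) j, by simp⟩

theorem not_isBraidFree_block_append_block_append_singleton (l : List (Fin n)) {i i' : ℕ}
    {s : Fin n} (hi : i ≤ s + 1) (hi' : i' ≤ s) (hs : 1 ≤ (s : ℕ)) :
    ¬ IsBraidFree (CoxeterMatrix.A n) (l ++ block n i (s + 1) ++ block n i' s ++ [s]) := by
  intro h
  let t : Fin n := ⟨s - 1, by omega⟩
  have ht : (t : ℕ) + 1 = s := Nat.sub_add_cancel hs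
  have split : block n i' s = block n i' t ++ [t] := by
    rw [← ht]
    exact block_succ_right t (ht ▸ hi')
  have hequiv := (commEquiv_block_append_singleton (i := i') (j := t) (s := s)
    (.inl (by omega))).symm.append (l ++ block n i s) [t, s]
  refine (h _ (by simpa [block_succ_right s hi, split] using hequiv)).2 s t
    ((typeA_eq_three_iff s t).2 (.inr ht)) ⟨l ++ block n i s ++ block n i' t, [], by simp⟩

theorem IsNormal.lt_of_isBraidFree {L : List (ℕ × ℕ)} {i : ℕ} {s : Fin n} (hs : 1 ≤ (s : ℕ))
    (hL : IsNormal n (L ++ [(i, (s : ℕ))]))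
    (h : IsBraidFree (CoxeterMatrix.A n) (normalWord n L ++ block n i s ++ [s])) :
    ∀ r ∈ L, (s : ℕ) + 1 < r.2 := by
  obtain ⟨hL, hlt, -, hi, -⟩ := isNormal_append_singleton.1 hL
  rcases List.eq_nil_or_concat' L with rfl | ⟨L, ⟨i₀, j₀⟩, rfl⟩
  · simp
  obtain ⟨-, hlt₀, -, hi₀, -⟩ := isNormal_append_singleton.1 hL
  have hj₀ : (s : ℕ) < j₀ := (hlt (i₀, j₀) (by simp)).2
  have hne : j₀ ≠ s + 1 := by
    rintro rfl
    rw [normalWord_append_singleton] at h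
    exact not_isBraidFree_block_append_block_append_singleton _ hi₀ hi hs h
  rw [List.forall_mem_append, List.forall_mem_singleton]
  exact ⟨fun r hr => by have := (hlt₀ r hr).2; omega, by omega⟩

theorem IsNormal.exists_commEquiv_of_forall_lt {L : List (ℕ × ℕ)} (hL : IsNormal n L) (s : Fin n)
    (hlt : ∀ r ∈ L, (s : ℕ) + 1 < r.1 ∧ (s : ℕ) + 1 < r.2) :
    ∃ L', IsNormal n L' ∧
      CommEquiv (CoxeterMatrix.A n) (normalWord n L ++ [s]) (normalWord n L') ∧
      ∀ a b : ℕ, a ≤ s → b ≤ s → (∀ r ∈ L, a < r.1 ∧ b < r.2) →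
        ∀ r ∈ L', a < r.1 ∧ b < r.2 := by
  refine ⟨L ++ [((s : ℕ) + 1, (s : ℕ) + 1)], isNormal_append_singleton.2
    ⟨hL, hlt, by omega, le_rfl, s.isLt⟩, ?_, fun a b _ _ hab => ?_⟩
  · rw [normalWord_append_singleton, block_self]
  · rw [List.forall_mem_append, List.forall_mem_singleton]
    exact ⟨hab, by omega, by omega⟩

/-- The last clause carries the induction: it says where the pairs of `L'` can lie when the letter
has been moved to the left of a block. -/
theorem IsNormal.exists_commEquiv_append_singleton {L : List (ℕ × ℕ)} (hL : IsNormal n L)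
    (s : Fin n) (h : IsBraidFree (CoxeterMatrix.A n) (normalWord n L ++ [s])) :
    ∃ L', IsNormal n L' ∧
      CommEquiv (CoxeterMatrix.A n) (normalWord n L ++ [s]) (normalWord n L') ∧
      ∀ a b : ℕ, a ≤ s → b ≤ s → (∀ r ∈ L, a < r.1 ∧ b < r.2) → ∀ r ∈ L', a < r.1 ∧ b < r.2 := by
  have hsn := s.isLt
  induction L using List.reverseRecOn with
  | nil => exact hL.exists_commEquiv_of_forall_lt s (by simp)
  | append_singleton L p ih =>
    obtain ⟨i, j⟩ := p
    obtain ⟨hL', hlt, hi, hij, hj⟩ := isNormal_append_singleton.1 hL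
    dsimp only at hlt hi hij hj
    rcases lt_or_ge (s + 1 : ℕ) i with hsi | hsi
    · refine hL.exists_commEquiv_of_forall_lt s ?_
      rw [List.forall_mem_append, List.forall_mem_singleton]
      exact ⟨fun r hr => by have := hlt r hr; omega, hsi, by omega⟩
    rw [normalWord_append_singleton] at h ⊢
    rcases lt_or_ge (s : ℕ) j with hsj | hsj
    · exact absurd h (not_isBraidFree_block_append_singleton _ hsi hsj hj)
    rcases hsj.eq_or_lt with rfl | hsj
    · have hlt' := hL.lt_of_isBraidFree (by omega) h
      refine ⟨L ++ [(i, (s : ℕ) + 1)], isNormal_append_singleton.2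
        ⟨hL', fun r hr => ⟨(hlt r hr).1, hlt' r hr⟩, hi, hsi, hsn⟩, ?_, fun a b _ _ hab => ?_⟩
      · rw [normalWord_append_singleton, block_succ_right s hsi, List.append_assoc]
      · rw [List.forall_mem_append, List.forall_mem_singleton] at hab ⊢
        exact ⟨hab.1, hab.2.1, by omega⟩
    · have hequiv : CommEquiv (CoxeterMatrix.A n) (normalWord n L ++ block n i j ++ [s])
          (normalWord n L ++ [s] ++ block n i j) := by
        simpa using (commEquiv_block_append_singleton (.inl hsj)).append (normalWord n L) []
      obtain ⟨L', hN, hequiv', hbound⟩ := ih hL'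
        (IsBraidFree.of_append fun ω' hω' => h ω' (hequiv.trans hω'))
      refine ⟨L' ++ [(i, j)], isNormal_append_singleton.2
        ⟨hN, hbound i j (by omega) (by omega) hlt, hi, hij, hj⟩, ?_, fun a b ha hb hab => ?_⟩
      · rw [normalWord_append_singleton]
        exact hequiv.trans (by simpa using hequiv'.append [] (block n i j))
      · rw [List.forall_mem_append, List.forall_mem_singleton] at hab ⊢
        exact ⟨hbound a b ha hb hab.1, hab.2⟩

theorem IsBraidFree.exists_isNormal {ω : List (Fin n)} (h : IsBraidFree (CoxeterMatrix.A n) ω) :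
    ∃ L, IsNormal n L ∧ CommEquiv (CoxeterMatrix.A n) ω (normalWord n L) := by
  induction ω using List.reverseRecOn with
  | nil => exact ⟨[], ⟨List.Pairwise.nil, by simp⟩, .refl⟩
  | append_singleton ω s ih =>
    obtain ⟨L, hL, hequiv⟩ := ih h.of_append
    have hequiv' : CommEquiv (CoxeterMatrix.A n) (ω ++ [s]) (normalWord n L ++ [s]) := by
      simpa using hequiv.append [] [s]
    obtain ⟨L', hL', hequiv'', -⟩ := hL.exists_commEquiv_append_singleton s
      fun ω' hω' => h ω' (hequiv'.trans hω')
    exact ⟨L', hL', hequiv'.trans hequiv''⟩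

end TypeA

section Reconnect

/-! ### Reconnecting an involution -/

variable {α : Type*} [DecidableEq α]

/-- Joins `a` with `b`, and the former partner of `a` with the former partner of `b`: the effect on
a matching, given as an involution `f`, of drawing a new arc between `a` and `b`. -/
def reconnect (a b : α) (f : α → α) (z : α) : α :=
  if z = a then b else if z = b then a else
    if z = f a then f b else if z = f b then f a else f z

variable {f : α → α} {a b c d z : α}

theorem reconnect_apply_left : reconnect a b f a = b := by
  simp [reconnect]

theorem reconnect_apply_right : reconnect a b f b = a := by
  simp +contextual [reconnect]

theorem reconnect_apply_partner (ha : f a ≠ a) (hab : f a ≠ b) :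
    reconnect a b f (f a) = f b := by
  simp [reconnect, ha, hab]

theorem reconnect_apply_of_ne (hf : f.Involutive) (hza : z ≠ a) (hzb : z ≠ b) (hfa : f z ≠ a)
    (hfb : f z ≠ b) : reconnect a b f z = f z := by
  have hfa' : z ≠ f a := fun h => hfa (hf.eq_iff.2 h)
  have hfb' : z ≠ f b := fun h => hfb (hf.eq_iff.2 h)
  simp only [reconnect, if_neg, *, not_false_eq_true]

theorem reconnect_involutive (hf : f.Involutive) (ha : f a ≠ a) (hb : f b ≠ b) :
    (reconnect a b f).Involutive := by
  intro z
  have hz := hf z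
  have haa := hf a
  have hbb := hf b
  grind [reconnect]

theorem reconnect_apply_ne (hf : f.Involutive) (hab : a ≠ b) (hz : f z ≠ z) :
    reconnect a b f z ≠ z := by
  have haa := hf a
  have hbb := hf b
  grind [reconnect]

theorem reconnect_comm (a b : α) (f : α → α) : reconnect a b f = reconnect b a f := by
  funext z
  grind [reconnect]

theorem reconnect_of_apply_eq (hab : f a = b) (hba : f b = a) : reconnect a b f = f := by
  funext z
  grind [reconnect]

theorem reconnect_reconnect_of_apply_eq (hf : f.Involutive) (h : f b = c) (hbc : b ≠ c)
    (hac : a ≠ c) : reconnect b c (reconnect a b f) = f := by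
  have hb := hf b
  have ha := hf a
  funext z
  grind [reconnect]

theorem reconnect_reconnect_reconnect (hf : f.Involutive) (ha : f a ≠ a) (hb : f b ≠ b)
    (hab : a ≠ b) (hac : a ≠ c) :
    reconnect a b (reconnect b c (reconnect a b f)) = reconnect a b f := by
  rw [reconnect_comm b c, reconnect_comm a b (reconnect c b _)]
  exact reconnect_reconnect_of_apply_eq (reconnect_involutive hf ha hb) reconnect_apply_right
    hab.symm hac.symm

theorem reconnect_commute (hf : f.Involutive) (hac : a ≠ c) (had : a ≠ d) (hbc : b ≠ c)
    (hbd : b ≠ d) (hab : a ≠ b) (hcd : c ≠ d) (ha : f a ≠ a) (hb : f b ≠ b) (hc : f c ≠ c)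
    (hd : f d ≠ d) :
    reconnect a b (reconnect c d f) = reconnect c d (reconnect a b f) := by
  have hinj := hf.injective
  have haa := hf a
  have hbb := hf b
  have hcc := hf c
  have hdd := hf d
  funext z
  have hz := hf z
  grind (splits := 30) [reconnect]

end Reconnect

section Planar

/-! ### Planar involutions -/

variable {f : ℤ → ℤ} {a b x y z : ℤ}

/-- The arcs that join each integer with its image do not cross. -/
def IsPlanar (f : ℤ → ℤ) : Prop :=
  ∀ x y, x < y → y < f x → x < f y ∧ f y < f x

/-- `z` lies between `x` and `y`, in whichever order these come. Only meant for `z ≠ x` and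
`z ≠ y`. -/
def IsBetween (x y z : ℤ) : Prop := x < z ↔ z < y

theorem isBetween_comm (hx : z ≠ x) (hy : z ≠ y) : IsBetween x y z ↔ IsBetween y x z := by
  unfold IsBetween
  omega

/-- No arc of `f` crosses the arc from `x` to `f x`. -/
def IsUncrossed (f : ℤ → ℤ) (x : ℤ) : Prop :=
  ∀ y, y ≠ x → y ≠ f x → (IsBetween x (f x) (f y) ↔ IsBetween x (f x) y)

theorem IsUncrossed.apply (hf : f.Involutive) (h : IsUncrossed f x) : IsUncrossed f (f x) := by
  intro y hy hyx
  rw [hf x] at hyx ⊢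
  rw [isBetween_comm hy hyx, ← h y hyx hy,
    isBetween_comm (hf.injective.ne hyx) fun h => hy (hf.eq_iff.1 h)]

theorem isPlanar_iff_forall_isUncrossed (hf : f.Involutive) :
    IsPlanar f ↔ ∀ x, IsUncrossed f x := by
  unfold IsUncrossed IsBetween
  refine ⟨fun h x y hyx hyfx => ?_, fun h x y hxy hyfx => ?_⟩
  · have hne : f y ≠ x := fun h => hyfx (hf.eq_iff.1 h)
    have hne' : f y ≠ f x := hf.injective.ne hyx
    have h₁ := h x y
    have h₂ := h x (f y)
    have h₃ := h (f x) y
    have h₄ := h (f x) (f y)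
    rw [hf y] at h₂ h₄
    rw [hf x] at h₃ h₄
    omega
  · have := h x y
    omega

theorem reconnect_iff {α : Type*} [DecidableEq α] {f : α → α} {a b z : α} {P : α → Prop}
    (hab : P a ↔ P b) (hfab : P (f a) ↔ P (f b))
    (hz : z ≠ a → z ≠ b → z ≠ f a → z ≠ f b → (P (f z) ↔ P z)) :
    P (reconnect a b f z) ↔ P z := by
  grind [reconnect]

theorem isBetween_reconnect (hf : f.Involutive) (hab : a < b)
    (hbet : ∀ c, a < c → c < b → a < f c ∧ f c < b) :
    IsBetween a b (reconnect a b f y) ↔ IsBetween a b y := by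
  have hout : ∀ c, c = a ∨ c = b → ¬ (a < f c ∧ f c < b) := fun c hc h => by
    have := hbet (f c) h.1 h.2
    rw [hf c] at this
    omega
  unfold IsBetween
  refine reconnect_iff (P := fun y => a < y ↔ y < b) (by omega) ?_ fun _ _ _ _ => ?_
  · have := hout a (.inl rfl)
    have := hout b (.inr rfl)
    omega
  · have := hbet y
    have := hbet (f y)
    rw [hf y] at this
    omega

theorem isBetween_apply_of_forall (hf : f.Involutive) (hab : a < b)
    (hbet : ∀ c, a < c → c < b → a < f c ∧ f c < b) :
    IsBetween a b (f y) ↔ IsBetween a b y := by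
  have := hbet y
  have := hbet (f y)
  rw [hf y] at this
  unfold IsBetween
  omega

theorem isBetween_left_iff_right (hab : a < b) (hxa : x ≠ a) (hxb : x ≠ b) (hya : y ≠ a)
    (hyb : y ≠ b) (hx : ¬ IsBetween a b x) (hy : ¬ IsBetween a b y) :
    IsBetween x y a ↔ IsBetween x y b := by
  unfold IsBetween at *
  omega

theorem IsPlanar.isBetween_partners_reconnect (hf : f.Involutive) (hp : IsPlanar f) (hab : a < b)
    (hbet : ∀ c, a < c → c < b → a < f c ∧ f c < b) (ha : f a ≠ a) (hb : f b ≠ b) (hfab : f a ≠ b)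
    (hya : y ≠ f a) (hyb : y ≠ f b) :
    IsBetween (f a) (f b) (reconnect a b f y) ↔ IsBetween (f a) (f b) y := by
  have hfba : f b ≠ a := fun h => hfab (hf.eq_iff.1 h).symm
  have hane : f a ≠ f b := hf.injective.ne hab.ne
  have hend : ∀ c, c = a ∨ c = b → ¬ IsBetween a b (f c) := fun c hc => by
    rw [isBetween_apply_of_forall hf hab hbet]
    unfold IsBetween
    omega
  rw [isPlanar_iff_forall_isUncrossed hf] at hp
  refine reconnect_iff ?_ ?_ fun hya' hyb' _ _ => ?_
  · exact isBetween_left_iff_right hab ha hfab hfba hb (hend a (.inl rfl)) (hend b (.inr rfl))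
  · unfold IsBetween
    omega
  · have hsplit : ∀ z, z ≠ a → z ≠ b → z ≠ f a → z ≠ f b → (IsBetween (f a) (f b) z ↔
        (IsBetween a (f a) z ↔ (IsBetween a b z ↔ IsBetween b (f b) z))) := fun z _ _ _ _ => by
      unfold IsBetween
      omega
    rw [hsplit y hya' hyb' hya hyb, hsplit (f y) (fun h => hya (hf.eq_iff.1 h))
      (fun h => hyb (hf.eq_iff.1 h)) (hf.injective.ne hya') (hf.injective.ne hyb'), hp a y hya' hya,
      hp b y hyb' hyb, isBetween_apply_of_forall hf hab hbet]

theorem IsPlanar.isBetween_apply_reconnect (hf : f.Involutive) (hp : IsPlanar f) (hab : a < b)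
    (hbet : ∀ c, a < c → c < b → a < f c ∧ f c < b) (hxa : x ≠ a) (hxb : x ≠ b) (hfxa : f x ≠ a)
    (hfxb : f x ≠ b) (hyx : y ≠ x) (hyfx : y ≠ f x) :
    IsBetween x (f x) (reconnect a b f y) ↔ IsBetween x (f x) y := by
  rw [isPlanar_iff_forall_isUncrossed hf] at hp
  have hxab : IsBetween x (f x) a ↔ IsBetween x (f x) b := by
    have := isBetween_apply_of_forall (y := x) hf hab hbet
    unfold IsBetween at *
    omega
  refine reconnect_iff hxab ?_ fun _ _ _ _ => hp x y hyx hyfx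
  rw [hp x a hxa.symm hfxa.symm, hp x b hxb.symm hfxb.symm, hxab]

theorem isPlanar_reconnect (hf : f.Involutive) (hp : IsPlanar f) (hab : a < b) (ha : f a ≠ a)
    (hb : f b ≠ b) (hbet : ∀ c, a < c → c < b → a < f c ∧ f c < b) :
    IsPlanar (reconnect a b f) := by
  by_cases hfab : f a = b
  · rwa [reconnect_of_apply_eq hfab (hf.eq_iff.1 hfab).symm]
  have hg := reconnect_involutive hf ha hb
  have hga : reconnect a b f a = b := reconnect_apply_left
  have hgfa : reconnect a b f (f a) = f b := reconnect_apply_partner ha hfab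
  have huncrossed_left : IsUncrossed (reconnect a b f) a := fun y _ _ => by
    rw [hga]
    exact isBetween_reconnect hf hab hbet
  have huncrossed_partner : IsUncrossed (reconnect a b f) (f a) := fun y hya hyb => by
    rw [hgfa] at hyb ⊢
    exact hp.isBetween_partners_reconnect hf hab hbet ha hb hfab hya hyb
  rw [isPlanar_iff_forall_isUncrossed hg]
  intro x
  rcases eq_or_ne x a with rfl | hxa
  · exact huncrossed_left
  rcases eq_or_ne x b with rfl | hxb
  · simpa only [hga] using huncrossed_left.apply hg
  rcases eq_or_ne (f x) a with rfl | hfxa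
  · simpa only [hf x] using huncrossed_partner
  rcases eq_or_ne (f x) b with rfl | hfxb
  · simpa only [hgfa, hf x] using huncrossed_partner.apply hg
  intro y hyx hyx'
  rw [reconnect_apply_of_ne hf hxa hxb hfxa hfxb] at hyx' ⊢
  exact hp.isBetween_apply_reconnect hf hab hbet hxa hxb hfxa hfxb hyx hyx'

end Planar

section Matching

/-! ### Matchings of the dots -/

variable {N i x y : ℤ} {f : ℤ → ℤ}

/-- A diagram on `N` strings whose arcs need not be planar, as the involution that exchanges the
endpoints of every arc. The dot `x` of the top row is encoded by `-x` and the dot `y'` of the bottom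
row by `y`. The integer `0` is not a dot, and the integers beyond `±N` are joined vertically. -/
structure IsMatching (N : ℤ) (f : ℤ → ℤ) : Prop where
  involutive : f.Involutive
  map_zero : f 0 = 0
  ne : ∀ z, z ≠ 0 → f z ≠ z
  eq_neg : ∀ z, N < |z| → f z = -z

theorem isMatching_neg (N : ℤ) : IsMatching N Neg.neg :=
  ⟨neg_involutive, neg_zero, fun z hz => by omega, fun _ _ => rfl⟩

theorem IsMatching.apply_ne_zero (hf : IsMatching N f) (hx : x ≠ 0) : f x ≠ 0 :=
  fun h => hx (hf.involutive.injective (h.trans hf.map_zero.symm))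

theorem IsMatching.abs_apply_le (hf : IsMatching N f) (hx : |x| ≤ N) : |f x| ≤ N := by
  by_contra! h
  have hout := hf.eq_neg _ h
  rw [hf.involutive, eq_neg_iff_add_eq_zero, add_comm, ← eq_neg_iff_add_eq_zero] at hout
  rw [hout, abs_neg] at h
  exact hx.not_gt h

theorem isMatching_reconnect (hf : IsMatching N f) (hxy : x ≠ y) (hx : x ≠ 0) (hy : y ≠ 0)
    (hxN : |x| ≤ N) (hyN : |y| ≤ N) : IsMatching N (reconnect x y f) where
  involutive := reconnect_involutive hf.involutive (hf.ne x hx) (hf.ne y hy)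
  map_zero := by
    rw [reconnect_apply_of_ne hf.involutive hx.symm hy.symm] <;> rw [hf.map_zero]
    exacts [hx.symm, hy.symm]
  ne z hz := reconnect_apply_ne hf.involutive hxy (hf.ne z hz)
  eq_neg z hz := by
    have hfz := hf.eq_neg z hz
    rw [reconnect_apply_of_ne hf.involutive] <;> grind

/-- `x` is the tail of an arc joining two dots of the top row or of an arc going to the right. -/
def IsTail (f : ℤ → ℤ) (x : ℤ) : Prop :=
  f (-x) < -x ∨ x < f (-x)

/-- `y'` is the head of an arc joining two dots of the bottom row or of an arc going to the
right. -/
def IsHead (f : ℤ → ℤ) (y : ℤ) : Prop :=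
  -y < f y ∧ f y < y

theorem isTail_reconnect_iff (hf : IsMatching N f) (hi : -i ≤ f i) (hi' : f i < i)
    (hhead : ¬ IsHead f (i + 1)) (hx : 0 < x) :
    IsTail (reconnect i (i + 1) f) x ↔ IsTail f x ∨ f i = -x := by
  have hfi := hf.involutive i
  have hfi' := hf.involutive (i + 1)
  have hne := hf.ne (i + 1) (by omega)
  unfold IsHead at hhead
  unfold IsTail
  by_cases hxi : f i = -x
  · have hval : reconnect i (i + 1) f (f i) = f (i + 1) := by grind [reconnect]
    rw [← hxi, hval]
    omega
  · by_cases hxi' : f (i + 1) = -x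
    · have hval : reconnect i (i + 1) f (f (i + 1)) = f i := by grind [reconnect]
      rw [← hxi', hval, hfi']
      omega
    · rw [reconnect_apply_of_ne hf.involutive (by omega) (by omega)
        (fun h => hxi (hf.involutive.eq_iff.1 h).symm)
        (fun h => hxi' (hf.involutive.eq_iff.1 h).symm)]
      simp only [hxi, or_false]

theorem isHead_reconnect_iff (hf : IsMatching N f) (hi : -i ≤ f i) (hi' : f i < i)
    (hhead : ¬ IsHead f (i + 1)) (hy : 0 < y) :
    IsHead (reconnect i (i + 1) f) y ↔ IsHead f y ∧ y ≠ i ∨ y = i + 1 := by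
  have hfi := hf.involutive i
  have hfi' := hf.involutive (i + 1)
  have hne := hf.ne (i + 1) (by omega)
  unfold IsHead at *
  rcases eq_or_ne y i with rfl | hyi
  · rw [reconnect_apply_left]
    omega
  rcases eq_or_ne y (i + 1) with rfl | hyi'
  · rw [reconnect_apply_right]
    omega
  by_cases hfy : f i = y
  · have hval : reconnect i (i + 1) f (f i) = f (i + 1) := by grind [reconnect]
    rw [← hfy, hval]
    omega
  by_cases hfy' : f (i + 1) = y
  · have hval : reconnect i (i + 1) f (f (i + 1)) = f i := by grind [reconnect]
    rw [← hfy', hval, hfi']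
    omega
  · rw [reconnect_apply_of_ne hf.involutive hyi hyi'
      (fun h => hfy (hf.involutive.eq_iff.1 h).symm)
      (fun h => hfy' (hf.involutive.eq_iff.1 h).symm)]
    simp only [hyi, hyi', ne_eq, not_false_eq_true, and_true, or_false]

/-- How the product with a block `[i, j]` changes the matching `f` into `g`. The last two clauses
allow blocks to be treated letter by letter and words block by block. -/
structure IsBlockEffect (f g : ℤ → ℤ) (i j : ℤ) : Prop where
  isTail_iff : ∀ x, 0 < x → (IsTail g x ↔ IsTail f x ∨ x = i)
  isHead_iff : ∀ y, 0 < y → (IsHead g y ↔ IsHead f y ∨ y = j + 1)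
  cup : g (j + 1) = j
  eq_neg : ∀ x, 0 < x → x < i → f x = -x → g x = -x

theorem isBlockEffect_reconnect (hf : IsMatching N f) (hi : 0 < i) (hfi : f i = -i)
    (hhead : ¬ IsHead f (i + 1)) : IsBlockEffect f (reconnect i (i + 1) f) i i where
  isTail_iff x hx := by
    rw [isTail_reconnect_iff hf (by omega) (by omega) hhead hx, hfi, neg_inj, eq_comm (a := i)]
  isHead_iff y hy := by
    have hnot : ¬ IsHead f i := fun h => by
      unfold IsHead at h
      omega
    rw [isHead_reconnect_iff hf (by omega) (by omega) hhead hy]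
    refine or_congr_left (and_iff_left_of_imp ?_)
    rintro h rfl
    exact hnot h
  cup := reconnect_apply_right
  eq_neg x hx hxi hfx := by
    rw [reconnect_apply_of_ne hf.involutive] <;> omega

theorem IsBlockEffect.reconnect {g : ℤ → ℤ} {j : ℤ} (h : IsBlockEffect f g i j) (hi : 0 < i)
    (hij : i ≤ j) (hg : IsMatching N g) (hhead : ∀ y, i < y → y ≤ j + 2 → ¬ IsHead f y) :
    IsBlockEffect f (reconnect (j + 1) (j + 2) g) i (j + 1) := by
  have hj := h.cup
  have hcup : ¬ IsHead g (j + 1 + 1) := by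
    rw [h.isHead_iff _ (by omega), not_or]
    exact ⟨hhead _ (by omega) (by omega), by omega⟩
  rw [show j + 2 = j + 1 + 1 by ring]
  refine ⟨fun x hx => ?_, fun y hy => ?_, reconnect_apply_right, fun x hx hxi hfx => ?_⟩
  · have hne : g (j + 1) ≠ -x := by omega
    rw [isTail_reconnect_iff hg (by omega) (by omega) hcup hx, or_iff_left hne, h.isTail_iff x hx]
  · rw [isHead_reconnect_iff hg (by omega) (by omega) hcup hy, h.isHead_iff y hy]
    grind
  · have hgx := h.eq_neg x hx hxi hfx
    rw [reconnect_apply_of_ne hg.involutive] <;> omega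

end Matching

section WordMatching

/-! ### The matching of a word -/

variable {n : ℕ} {ω ω' : List (Fin n)}

/-- The matching of the product of the diagrams `E_k` along a word, circles being ignored. -/
def wordMatching (ω : List (Fin n)) : ℤ → ℤ :=
  ω.foldl (fun (f : ℤ → ℤ) (k : Fin n) => reconnect ((k : ℤ) + 1) ((k : ℤ) + 2) f) Neg.neg

theorem wordMatching_append (ω r : List (Fin n)) : wordMatching (ω ++ r) =
    r.foldl (fun (f : ℤ → ℤ) (k : Fin n) => reconnect ((k : ℤ) + 1) ((k : ℤ) + 2) f)
      (wordMatching ω) :=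
  List.foldl_append

theorem wordMatching_append_singleton (ω : List (Fin n)) (k : Fin n) :
    wordMatching (ω ++ [k]) = reconnect ((k : ℤ) + 1) ((k : ℤ) + 2) (wordMatching ω) :=
  wordMatching_append ω [k]

theorem wordMatching_append_congr (h : wordMatching ω = wordMatching ω') (r : List (Fin n)) :
    wordMatching (ω ++ r) = wordMatching (ω' ++ r) := by
  rw [wordMatching_append, wordMatching_append, h]

theorem isMatching_wordMatching (ω : List (Fin n)) : IsMatching (n + 1) (wordMatching ω) := by
  induction ω using List.reverseRecOn with
  | nil => exact isMatching_neg _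
  | append_singleton ω k ih =>
    rw [wordMatching_append_singleton]
    apply isMatching_reconnect ih <;> grind

theorem isBlockEffect_block {i j : ℕ} (hi : 1 ≤ i) (hij : i ≤ j) (hj : j ≤ n)
    (hωi : wordMatching ω i = -i)
    (hhead : ∀ y : ℤ, (i : ℤ) < y → y ≤ j + 1 → ¬ IsHead (wordMatching ω) y) :
    IsBlockEffect (wordMatching ω) (wordMatching (ω ++ block n i j)) i j := by
  induction j, hij using Nat.le_induction with
  | base =>
    obtain ⟨m, rfl⟩ := Nat.exists_eq_add_of_le' hi
    have h := isBlockEffect_reconnect (isMatching_wordMatching ω) (by omega) hωi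
      (hhead _ (by omega) le_rfl)
    have hblock : block n (m + 1) (m + 1) = [⟨m, hj⟩] := block_self ⟨m, hj⟩
    rw [hblock, wordMatching_append_singleton]
    simpa [add_assoc] using h
  | succ j hij ih =>
    have h := (ih (by omega) fun y hy hy' => hhead y hy (by omega)).reconnect (by omega) (by omega)
      (isMatching_wordMatching _) (fun y hy hy' => hhead y hy (by push_cast; omega))
    have hblock : block n i (j + 1) = block n i j ++ [⟨j, hj⟩] :=
      block_succ_right ⟨j, hj⟩ (by dsimp only; omega)
    rw [hblock, ← List.append_assoc, wordMatching_append_singleton]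
    exact_mod_cast h

theorem IsNormal.wordMatching_spec {L : List (ℕ × ℕ)} (hL : IsNormal n L) :
    (∀ x : ℤ, 0 < x → (IsTail (wordMatching (normalWord n L)) x ↔ ∃ q ∈ L, x = q.1)) ∧
    (∀ y : ℤ, 0 < y → (IsHead (wordMatching (normalWord n L)) y ↔ ∃ q ∈ L, y = q.2 + 1)) ∧
    ∀ x : ℤ, 0 < x → (∀ q ∈ L, x < q.1) → wordMatching (normalWord n L) x = -x := by
  induction L using List.reverseRecOn with
  | nil =>
    simp only [IsTail, wordMatching, normalWord, List.flatMap_nil, List.foldl_nil, neg_neg,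
      lt_neg_self_iff, lt_self_iff_false, or_false, List.not_mem_nil, false_and, exists_const,
      iff_false, not_lt, IsHead, neg_lt_self_iff, implies_true, IsEmpty.forall_iff,
      and_self, and_true]
    omega
  | append_singleton L q ih =>
    obtain ⟨hL, hq, hi, hij, hj⟩ := isNormal_append_singleton.1 hL
    obtain ⟨htail, hhead, hneg⟩ := ih hL
    have h := isBlockEffect_block hi hij hj
      (hneg _ (by omega) fun r hr => by exact_mod_cast (hq r hr).1) fun y hy hy' hh => by
        obtain ⟨r, hr, rfl⟩ := (hhead y (by omega)).1 hh
        have := hq r hr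
        omega
    rw [normalWord_append_singleton]
    refine ⟨fun x hx => ?_, fun y hy => ?_, fun x hx hlt => ?_⟩
    · rw [h.isTail_iff x hx, htail x hx]
      simp only [List.mem_append, List.mem_singleton, or_and_right, exists_or, exists_eq_left]
    · rw [h.isHead_iff y hy, hhead y hy]
      simp only [List.mem_append, List.mem_singleton, or_and_right, exists_or, exists_eq_left]
    · rw [List.forall_mem_append, List.forall_mem_singleton] at hlt
      exact h.eq_neg x hx hlt.2 (hneg x hx hlt.1)

theorem IsNormal.exists_fst_eq_iff {L : List (ℕ × ℕ)} (hL : IsNormal n L) {i : ℕ} :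
    (∃ q ∈ L, q.1 = i) ↔ 0 < i ∧ IsTail (wordMatching (normalWord n L)) i := by
  have hspec := hL.wordMatching_spec.1 i
  refine ⟨?_, fun ⟨_, h⟩ => ?_⟩
  · rintro ⟨q, hq, rfl⟩
    have hpos : 0 < q.1 := (hL.2 q hq).1
    exact ⟨hpos, (hspec (by omega)).2 ⟨q, hq, rfl⟩⟩
  · obtain ⟨q, hq, hqi⟩ := (hspec (by omega)).1 h
    exact ⟨q, hq, by omega⟩

theorem IsNormal.exists_snd_eq_iff {L : List (ℕ × ℕ)} (hL : IsNormal n L) {j : ℕ} :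
    (∃ q ∈ L, q.2 = j) ↔ IsHead (wordMatching (normalWord n L)) (j + 1) := by
  rw [hL.wordMatching_spec.2.1 _ (by omega)]
  exact exists_congr fun q => and_congr_right fun _ => by omega

end WordMatching

section Generation

/-! ### Planar matchings come from words -/

variable {N m k a y : ℤ} {f : ℤ → ℤ} {n : ℕ}

/-- A planar matching on `N` strings whose strings to the left of the place `m` are vertical. -/
structure IsPlanarFrom (N m : ℤ) (f : ℤ → ℤ) : Prop extends IsMatching N f where
  isPlanar : IsPlanar f
  eq_neg_of_lt : ∀ x, |x| < m → f x = -x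

theorem IsPlanarFrom.le_abs_apply (hf : IsPlanarFrom N m f) (hy : m ≤ |y|) : m ≤ |f y| := by
  by_contra! h
  have := hf.eq_neg_of_lt _ h
  rw [hf.involutive] at this
  rw [this, abs_neg] at hy
  exact hy.not_gt h

theorem IsPlanarFrom.isPlanarFrom_reconnect (hf : IsPlanarFrom N m f) (hm : 0 < m) (hak : a < k)
    (ha : m ≤ |a|) (hk : m ≤ |k|) (haN : |a| ≤ N) (hkN : |k| ≤ N)
    (hbet : ∀ c, a < c → c < k → a < f c ∧ f c < k) : IsPlanarFrom N m (reconnect a k f) where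
  toIsMatching := isMatching_reconnect hf.toIsMatching hak.ne (by grind) (by grind) haN hkN
  isPlanar := isPlanar_reconnect hf.involutive hf.isPlanar hak (hf.ne a (by grind))
    (hf.ne k (by grind)) hbet
  eq_neg_of_lt x hx := by
    have hfx := hf.eq_neg_of_lt x hx
    rw [reconnect_apply_of_ne hf.involutive] <;> grind

theorem IsPlanarFrom.of_apply_eq_neg (hf : IsPlanarFrom N m f) (h : f m = -m) :
    IsPlanarFrom N (m + 1) f where
  toIsMatching := hf.toIsMatching
  isPlanar := hf.isPlanar
  eq_neg_of_lt x hx := by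
    have h' : f (-m) = m := by rw [← h, hf.involutive]
    have := hf.eq_neg_of_lt x
    grind

theorem IsPlanar.exists_cup_of_lt_apply (hp : IsPlanar f) (hne : ∀ z, a ≤ z → f z ≠ z)
    (h : a < f a) : ∃ k, a ≤ k ∧ k + 1 ≤ f a ∧ f k = k + 1 := by
  induction hd : (f a - a).toNat using Nat.strong_induction_on generalizing a with
  | _ d ih =>
    rcases (Int.add_one_le_of_lt h).eq_or_lt with hcup | hlt
    · exact ⟨a, le_rfl, hcup.le, hcup.symm⟩
    have hin := hp a (a + 1) (by omega) hlt
    have hne' := hne (a + 1) (by omega)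
    obtain ⟨k, hak, hkf, hk⟩ := ih (f (a + 1) - (a + 1)).toNat (by omega)
      (fun z hz => hne z (by omega)) (by omega) rfl
    exact ⟨k, by omega, by omega, hk⟩

theorem IsPlanarFrom.apply_eq_neg (hf : IsPlanarFrom N m f) (hm : 0 < m)
    (h : ∀ y, m ≤ y → f y < y) : f m = -m := by
  have hneg : ∀ y, m ≤ y → f y ≤ -m := fun y hy => by
    have habs := hf.le_abs_apply (y := y) (by grind)
    have hback := h (f y)
    rw [hf.involutive] at hback
    have := h y hy
    grind
  -- As the arcs are nested, `f` decreases strictly from `m` on, and it is `Neg.neg` beyond `N`.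
  have hanti : ∀ y, m ≤ y → f (y + 1) < f y := fun y hy => by
    have hnest := hf.isPlanar (f (y + 1)) y
    have := hneg (y + 1) (by omega)
    rw [hf.involutive] at hnest
    omega
  have hge : ∀ d : ℕ, ∀ y, m ≤ y → N < y + d → -y ≤ f y := fun d => by
    induction d with
    | zero => exact fun y hy hyN => (hf.eq_neg y (by grind)).ge
    | succ d ih =>
      intro y hy hyN
      have := ih (y + 1) (by omega) (by omega)
      have := hanti y hy
      omega
  exact le_antisymm (hneg m le_rfl) (hge (N - m + 1).toNat m le_rfl (by omega))

theorem IsPlanarFrom.exists_cup (hf : IsPlanarFrom N m f) (hm : 0 < m) (hne : f m ≠ -m) :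
    ∃ k, m ≤ k ∧ k + 1 ≤ N ∧ f k = k + 1 := by
  have hne' : ∀ z, m ≤ z → f z ≠ z := fun z hz => hf.ne z (by omega)
  obtain ⟨y, hy, hlt⟩ : ∃ y, m ≤ y ∧ y < f y := by
    by_contra! h
    exact hne (hf.apply_eq_neg hm fun y hy => (h y hy).lt_of_ne (hne' y hy))
  obtain ⟨k, hyk, hkf, hk⟩ := hf.isPlanar.exists_cup_of_lt_apply
    (fun z hz => hne' z (hy.trans hz)) hlt
  have hyN : |y| ≤ N := by
    by_contra! h
    have := hf.eq_neg y h
    omega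
  have := (abs_le.1 (hf.abs_apply_le hyN)).2
  exact ⟨k, by omega, by omega, hk⟩

theorem mem_range_wordMatching_of_reconnect (hf : f.Involutive) (hk : 0 < k) (hkn : k ≤ n)
    (hcup : f k = k + 1) (hak : a < k) (h : reconnect a k f ∈ Set.range (wordMatching (n := n))) :
    f ∈ Set.range (wordMatching (n := n)) := by
  obtain ⟨ω, hω⟩ := h
  have hcast : (((k - 1).toNat : ℕ) : ℤ) = k - 1 := by omega
  refine ⟨ω ++ [⟨(k - 1).toNat, by omega⟩], ?_⟩
  rw [wordMatching_append_singleton, hω]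
  dsimp only
  rw [hcast, sub_add_cancel, show k - 1 + 2 = k + 1 by ring,
    reconnect_reconnect_of_apply_eq hf hcup (by omega) (by omega)]

/-- The cup is slid to the left until it can be opened into vertical strings. -/
theorem IsPlanarFrom.mem_range_wordMatching_of_cup
    (ih : ∀ g, IsPlanarFrom (n + 1) (m + 1) g → g ∈ Set.range (wordMatching (n := n)))
    (hf : IsPlanarFrom (n + 1) m f) (hm : 0 < m) (hmk : m ≤ k) (hkn : k ≤ n) (hk : f k = k + 1) :
    f ∈ Set.range (wordMatching (n := n)) := by
  induction k, hmk using Int.leInduction generalizing f with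
  | base =>
    refine mem_range_wordMatching_of_reconnect hf.involutive hm hkn hk (by omega) (a := -m)
      (ih _ (IsPlanarFrom.of_apply_eq_neg ?_ reconnect_apply_right))
    refine hf.isPlanarFrom_reconnect hm (by omega) ?_ ?_ ?_ ?_ fun c hc hc' => ?_
    all_goals grind [hf.eq_neg_of_lt]
  | succ k hmk ihk =>
    refine mem_range_wordMatching_of_reconnect hf.involutive (by omega) hkn hk (lt_add_one k)
      (ihk ?_ (by omega) reconnect_apply_left)
    refine hf.isPlanarFrom_reconnect hm (by omega) ?_ ?_ ?_ ?_ fun c hc hc' => ?_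
    all_goals grind

theorem exists_wordMatching_eq (hf : IsMatching (n + 1) f) (hp : IsPlanar f) :
    ∃ ω : List (Fin n), wordMatching ω = f := by
  suffices h : ∀ d : ℕ, ∀ m : ℤ, 0 < m → n + 1 < m + d → ∀ f, IsPlanarFrom (n + 1) m f →
      f ∈ Set.range (wordMatching (n := n)) from
    h (n + 1) 1 one_pos (by omega) f ⟨hf, hp, fun x hx => by
      rw [Int.abs_lt_one_iff.1 hx, hf.map_zero, neg_zero]⟩
  intro d
  induction d with
  | zero =>
    intro m _ hmn f hf
    refine ⟨[], funext fun z => Eq.symm ?_⟩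
    exact (lt_or_ge |z| m).elim (hf.eq_neg_of_lt z) fun h => hf.eq_neg z (by omega)
  | succ d ih =>
    intro m hm hmn f hf
    have ih' := ih (m + 1) (by omega) (by omega)
    by_cases hfm : f m = -m
    · exact ih' f (hf.of_apply_eq_neg hfm)
    · obtain ⟨k, hmk, hkn, hk⟩ := hf.exists_cup hm hfm
      exact hf.mem_range_wordMatching_of_cup ih' hm hmk (by omega) hk

end Generation

section Shortest

/-! ### Shortest words of a matching -/

variable {n : ℕ} {ω ω' : List (Fin n)}

theorem CommStep.wordMatching_eq (h : CommStep (CoxeterMatrix.A n) ω ω') :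
    wordMatching ω = wordMatching ω' := by
  obtain ⟨l, r, s, t, hst, rfl, rfl⟩ := h
  rw [typeA_eq_two_iff] at hst
  have hm := isMatching_wordMatching l
  refine wordMatching_append_congr ?_ r
  simp only [wordMatching_append, List.foldl_cons, List.foldl_nil]
  apply reconnect_commute hm.involutive
  any_goals omega
  all_goals exact hm.ne _ (by omega)

theorem CommEquiv.wordMatching_eq (h : CommEquiv (CoxeterMatrix.A n) ω ω') :
    wordMatching ω = wordMatching ω' := by
  induction h with
  | refl => rfl
  | tail _ hstep ih => exact ih.trans hstep.wordMatching_eq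

/-- No shorter word has the same matching. -/
def IsShortest (ω : List (Fin n)) : Prop :=
  ∀ ω' : List (Fin n), wordMatching ω' = wordMatching ω → ω.length ≤ ω'.length

theorem exists_isShortest (ω : List (Fin n)) :
    ∃ ω' : List (Fin n), IsShortest ω' ∧ wordMatching ω' = wordMatching ω := by
  obtain ⟨ω', hω', hmin⟩ := exists_minimalFor_of_wellFoundedLT
    (fun ω' : List (Fin n) => wordMatching ω' = wordMatching ω) List.length ⟨ω, rfl⟩
  exact ⟨ω', fun η hη => (le_total _ _).elim id (hmin (hη.trans hω')), hω'⟩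

theorem IsShortest.commEquiv (h : IsShortest ω) (h' : CommEquiv (CoxeterMatrix.A n) ω ω') :
    IsShortest ω' := fun η hη =>
  h'.perm.length_eq ▸ h η (hη.trans h'.wordMatching_eq.symm)

theorem IsShortest.of_append {r : List (Fin n)} (h : IsShortest (ω ++ r)) : IsShortest ω := by
  intro η hη
  have := h (η ++ r) (wordMatching_append_congr hη r)
  simpa only [List.length_append, Nat.add_le_add_iff_right] using this

theorem IsShortest.apply_ne {k : Fin n} (h : IsShortest (ω ++ [k])) :
    wordMatching ω (k + 1) ≠ k + 2 := by
  intro hcup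
  have hinv := (isMatching_wordMatching ω).involutive
  have := h ω (by rw [wordMatching_append_singleton,
    reconnect_of_apply_eq hcup (hinv.eq_iff.1 hcup).symm])
  rw [List.length_append, List.length_singleton] at this
  omega

theorem IsShortest.isBraidFree (h : IsShortest ω) : IsBraidFree (CoxeterMatrix.A n) ω := by
  intro ω' hω'
  replace h := h.commEquiv hω'
  refine ⟨fun s => ?_, fun s t hst => ?_⟩
  · rintro ⟨l, r, rfl⟩
    rw [List.append_cons] at h
    exact h.of_append.apply_ne (by rw [wordMatching_append_singleton, reconnect_apply_left])
  · rintro ⟨l, r, rfl⟩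
    have hm := isMatching_wordMatching l
    have hshort : wordMatching (l ++ [s]) = wordMatching (l ++ [s, t, s]) := by
      simp only [wordMatching_append, List.foldl_cons, List.foldl_nil]
      rcases (typeA_eq_three_iff s t).1 hst with hst | hst
      · have hcast : ((t : ℕ) : ℤ) = s + 1 := by omega
        rw [hcast, add_assoc, one_add_one_eq_two, reconnect_reconnect_reconnect hm.involutive
          (hm.ne _ (by omega)) (hm.ne _ (by omega)) (by omega) (by omega)]
      · have hcast : ((s : ℕ) : ℤ) = t + 1 := by omega
        have hbraid := reconnect_reconnect_reconnect hm.involutive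
          (a := (t : ℤ) + 3) (b := t + 2) (c := t + 1) (hm.ne _ (by omega)) (hm.ne _ (by omega))
          (by omega) (by omega)
        rw [hcast, add_assoc, add_assoc, reconnect_comm _ _ (wordMatching l),
          reconnect_comm ((t : ℤ) + 1), reconnect_comm _ _ (reconnect _ _ (reconnect _ _ _))]
        exact hbraid.symm
    have := h.of_append _ hshort
    simp at this

theorem IsNormal.eq_of_mem_iff {L L' : List (ℕ × ℕ)} (hL : IsNormal n L) (hL' : IsNormal n L')
    (hfst : ∀ i, (∃ q ∈ L, q.1 = i) ↔ ∃ q ∈ L', q.1 = i)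
    (hsnd : ∀ j, (∃ q ∈ L, q.2 = j) ↔ ∃ q ∈ L', q.2 = j) : L = L' := by
  have heq_fst : L.map Prod.fst = L'.map Prod.fst :=
    (List.pairwise_map.2 (hL.1.imp And.left)).eq_of_mem_iff (r := (· > ·))
      (List.pairwise_map.2 (hL'.1.imp And.left)) fun i => by simpa only [List.mem_map] using hfst i
  have heq_snd : L.map Prod.snd = L'.map Prod.snd :=
    (List.pairwise_map.2 (hL.1.imp And.right)).eq_of_mem_iff (r := (· > ·))
      (List.pairwise_map.2 (hL'.1.imp And.right)) fun j => by simpa only [List.mem_map] using hsnd j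
  exact (List.zip_of_prod heq_fst heq_snd).trans (List.zip_of_prod rfl rfl).symm

theorem IsNormal.isShortest_normalWord {L : List (ℕ × ℕ)} (hL : IsNormal n L) :
    IsShortest (normalWord n L) := by
  obtain ⟨ω, hω, hmatch⟩ := exists_isShortest (normalWord n L)
  obtain ⟨L', hL', hequiv⟩ := hω.isBraidFree.exists_isNormal
  rw [hequiv.wordMatching_eq] at hmatch
  have heq : L' = L := hL'.eq_of_mem_iff hL
    (fun i => by rw [hL.exists_fst_eq_iff, hL'.exists_fst_eq_iff, hmatch])
    fun j => by rw [hL.exists_snd_eq_iff, hL'.exists_snd_eq_iff, hmatch]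
  exact heq ▸ hω.commEquiv hequiv

theorem exists_isNormal_wordMatching_eq {f : ℤ → ℤ} (hf : IsMatching (n + 1) f)
    (hp : IsPlanar f) : ∃ L, IsNormal n L ∧ wordMatching (normalWord n L) = f := by
  obtain ⟨ω, rfl⟩ := exists_wordMatching_eq hf hp
  obtain ⟨ω', hω', hmatch⟩ := exists_isShortest ω
  obtain ⟨L, hL, hequiv⟩ := hω'.isBraidFree.exists_isNormal
  exact ⟨L, hL, hequiv.wordMatching_eq.symm.trans hmatch⟩

end Shortest

section Diagrams

/-! ### The matching of a non-crossing diagram -/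

variable {n : ℕ} {D : Set (Dot n × Dot n)} {f : ℤ → ℤ} {u v s t : Dot n}

/-- The integer that encodes a dot in a matching. -/
def coord (d : Dot n) : ℤ :=
  Sum.elim (fun x : Fin (n + 1) => -((x : ℤ) + 1)) (fun x : Fin (n + 1) => (x : ℤ) + 1) (ofLex d)

@[simp]
theorem coord_top (x : Fin (n + 1)) : coord (top x) = -((x : ℤ) + 1) := rfl

@[simp]
theorem coord_bot (x : Fin (n + 1)) : coord (bot x) = (x : ℤ) + 1 := rfl

theorem exists_eq_top_or_exists_eq_bot (d : Dot n) : (∃ x, d = top x) ∨ ∃ x, d = bot x :=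
  match d with
  | .inl x => .inl ⟨x, rfl⟩
  | .inr x => .inr ⟨x, rfl⟩

theorem coord_injective : Function.Injective (coord : Dot n → ℤ) := by
  intro d e h
  rcases exists_eq_top_or_exists_eq_bot d with ⟨x, rfl⟩ | ⟨x, rfl⟩ <;>
    rcases exists_eq_top_or_exists_eq_bot e with ⟨y, rfl⟩ | ⟨y, rfl⟩ <;>
    simp only [coord_top, coord_bot] at h
  · rw [show x = y by omega]
  · omega
  · omega
  · rw [show x = y by omega]

theorem exists_coord_eq_iff {z : ℤ} : (∃ d : Dot n, coord d = z) ↔ z ≠ 0 ∧ |z| ≤ n + 1 := by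
  rw [abs_le]
  constructor
  · rintro ⟨d, rfl⟩
    rcases exists_eq_top_or_exists_eq_bot d with ⟨x, rfl⟩ | ⟨x, rfl⟩ <;>
      simp only [coord_top, coord_bot] <;> omega
  · rintro ⟨hz, hzn⟩
    rcases hz.lt_or_gt with hneg | hpos
    · exact ⟨top ⟨(-z - 1).toNat, by omega⟩, by simp only [coord_top]; omega⟩
    · exact ⟨bot ⟨(z - 1).toNat, by omega⟩, by simp only [coord_bot]; omega⟩

theorem coord_ne_zero (d : Dot n) : coord d ≠ 0 := (exists_coord_eq_iff.1 ⟨d, rfl⟩).1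

theorem abs_coord_le (d : Dot n) : |coord d| ≤ n + 1 := (exists_coord_eq_iff.1 ⟨d, rfl⟩).2

theorem IsMatching.exists_coord_eq_apply (hf : IsMatching (n + 1) f) (d : Dot n) :
    ∃ e : Dot n, coord e = f (coord d) :=
  exists_coord_eq_iff.2 ⟨hf.apply_ne_zero (coord_ne_zero d), hf.abs_apply_le (abs_coord_le d)⟩

/-- The diagram on `n + 1` strings whose arrows are the arcs of the matching `f`. -/
def toDiagram (n : ℕ) (f : ℤ → ℤ) : Set (Dot n × Dot n) :=
  {a | a.1 < a.2 ∧ f (coord a.1) = coord a.2}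

theorem idDiagram_eq_toDiagram : idDiagram n = toDiagram n Neg.neg := by
  ext ⟨d, e⟩
  simp only [idDiagram, toDiagram, Set.mem_ofPred_eq, Prod.mk.injEq]
  constructor
  · rintro ⟨x, rfl, rfl⟩
    exact ⟨Sum.Lex.inl_lt_inr x x, by simp only [coord_top, coord_bot, neg_neg]⟩
  · rintro ⟨hlt, h⟩
    rcases exists_eq_top_or_exists_eq_bot d with ⟨x, rfl⟩ | ⟨x, rfl⟩ <;>
      rcases exists_eq_top_or_exists_eq_bot e with ⟨y, rfl⟩ | ⟨y, rfl⟩ <;>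
      simp only [coord_top, coord_bot] at h
    · omega
    · exact ⟨x, rfl, by rw [show x = y by omega]⟩
    · exact absurd hlt Sum.Lex.not_inr_lt_inl
    · omega

theorem Joined.symm (h : Joined D u v) : Joined D v u := Or.symm h

theorem IsNonCrossingDiagram.mem_iff (hD : IsNonCrossingDiagram D) :
    (u, v) ∈ D ↔ u < v ∧ Joined D u v :=
  ⟨fun h => ⟨hD.lt _ h, Or.inl h⟩, fun ⟨hlt, h⟩ => h.resolve_right fun h => hlt.not_gt (hD.lt _ h)⟩

theorem IsNonCrossingDiagram.ne_of_joined (hD : IsNonCrossingDiagram D) (h : Joined D u v) :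
    u ≠ v :=
  h.elim (fun h => (hD.lt _ h).ne) fun h => (hD.lt _ h).ne'

theorem IsNonCrossingDiagram.existsUnique_joined (hD : IsNonCrossingDiagram D) (u : Dot n) :
    ∃! v, Joined D u v := by
  obtain ⟨⟨a, b⟩, ⟨hab, hu⟩, huniq⟩ := hD.existsUnique u
  have hne := (hD.lt _ hab).ne
  have heq : ∀ c d, (c, d) ∈ D → c = u ∨ d = u → c = a ∧ d = b := fun c d hcd hu =>
    Prod.mk.inj (huniq (c, d) ⟨hcd, hu⟩)
  rcases hu with rfl | rfl
  · refine ⟨b, Or.inl hab, fun v hv => hv.elim (fun h => (heq _ _ h (.inl rfl)).2) fun h => ?_⟩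
    exact absurd (heq _ _ h (.inr rfl)).2 hne
  · refine ⟨a, Or.inr hab, fun v hv => hv.elim (fun h => ?_) fun h => (heq _ _ h (.inr rfl)).1⟩
    exact absurd (heq _ _ h (.inl rfl)).1.symm hne

theorem IsNonCrossingDiagram.exists_partner (hD : IsNonCrossingDiagram D) :
    ∃ p : Dot n → Dot n, p.Involutive ∧ ∀ u v, Joined D u v ↔ p u = v := by
  choose p hp huniq using hD.existsUnique_joined
  exact ⟨p, fun u => (huniq _ _ (hp u).symm).symm, fun u v =>
    ⟨fun h => (huniq u v h).symm, fun h => h ▸ hp u⟩⟩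

theorem boundaryPos_eq (d : Dot n) :
    (boundaryPos d : ℤ) = if coord d < 0 then -coord d - 1 else 2 * n + 2 - coord d := by
  rcases exists_eq_top_or_exists_eq_bot d with ⟨x, rfl⟩ | ⟨x, rfl⟩
  · have hpos : boundaryPos (top x : Dot n) = x := rfl
    simp only [hpos, coord_top]
    omega
  · have hpos : boundaryPos (bot x : Dot n) = 2 * n + 1 - x := rfl
    simp only [hpos, coord_bot]
    omega

-- The order of the encodings is, up to a rotation, the reverse of the order along the boundary.
theorem IsNonCrossingDiagram.not_joined_of_coord_lt (hD : IsNonCrossingDiagram D)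
    (hus : coord u < coord s) (hsv : coord s < coord v) (hvt : coord v < coord t) :
    ¬ (Joined D u v ∧ Joined D s t) := by
  rintro ⟨huv, hst⟩
  have hcross := fun a b c d => hD.nonCrossing a b c d
  have hu := boundaryPos_eq u
  have hs := boundaryPos_eq s
  have hv := boundaryPos_eq v
  have ht := boundaryPos_eq t
  have hut : coord t < coord u + (2 * n + 3) := by
    have hu := abs_le.1 (abs_coord_le u)
    have ht := abs_le.1 (abs_coord_le t)
    omega
  by_cases hu0 : coord u < 0 <;> by_cases hs0 : coord s < 0 <;> by_cases hv0 : coord v < 0 <;>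
    by_cases ht0 : coord t < 0 <;> simp only [hu0, hs0, hv0, ht0, if_true, if_false] at hu hs hv ht
  all_goals first
    | omega
    | exact hcross t v s u (by omega) (by omega) (by omega) ⟨hst.symm, huv.symm⟩
    | exact hcross u t v s (by omega) (by omega) (by omega) ⟨huv, hst.symm⟩
    | exact hcross s u t v (by omega) (by omega) (by omega) ⟨hst, huv⟩
    | exact hcross v s u t (by omega) (by omega) (by omega) ⟨huv.symm, hst⟩

theorem exists_isMatching_extending {p : Dot n → Dot n} (hp : p.Involutive) (hne : ∀ d, p d ≠ d) :
    ∃ f, IsMatching (n + 1) f ∧ ∀ d, f (coord d) = coord (p d) := by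
  set f : ℤ → ℤ := Function.extend coord (coord ∘ p) Neg.neg
  have hcoord (d : Dot n) : f (coord d) = coord (p d) := coord_injective.extend_apply _ _ d
  have hout (z : ℤ) (hz : ¬ ∃ d : Dot n, coord d = z) : f z = -z :=
    Function.extend_apply' _ _ z hz
  refine ⟨f, ⟨fun z => ?_, ?_, fun z hz => ?_, fun z hz => hout z ?_⟩, hcoord⟩
  · by_cases h : ∃ d : Dot n, coord d = z
    · obtain ⟨d, rfl⟩ := h
      rw [hcoord, hcoord, hp]
    · rw [hout z h, hout (-z), neg_neg]
      rwa [exists_coord_eq_iff, neg_ne_zero, abs_neg, ← exists_coord_eq_iff]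
  · rw [hout 0 fun ⟨d, hd⟩ => coord_ne_zero d hd, neg_zero]
  · by_cases h : ∃ d : Dot n, coord d = z
    · obtain ⟨d, rfl⟩ := h
      rw [hcoord]
      exact coord_injective.ne (hne d)
    · rw [hout z h]
      omega
  · rw [exists_coord_eq_iff]
    omega

theorem IsMatching.isPlanar (hf : IsMatching (n + 1) f)
    (h : ∀ u s : Dot n, coord u < coord s → coord s < f (coord u) →
      ¬ f (coord u) < f (coord s)) : IsPlanar f := by
  intro x y hxy hyx
  have hx : x ≠ 0 := by
    rintro rfl
    rw [hf.map_zero] at hyx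
    omega
  rcases eq_or_ne y 0 with rfl | hy
  · rw [hf.map_zero]
    exact ⟨hxy, hyx⟩
  rcases lt_or_ge ((n : ℤ) + 1) |x| with hxN | hxN
  · have hfx := hf.eq_neg x hxN
    rw [lt_abs] at hxN
    rcases lt_or_ge ((n : ℤ) + 1) |y| with hyN | hyN
    · have hfy := hf.eq_neg y hyN
      omega
    · have hfy := abs_le.1 (hf.abs_apply_le hyN)
      omega
  have hfxN := abs_le.1 (hf.abs_apply_le hxN)
  have hyN : |y| ≤ n + 1 := by
    rw [abs_le] at hxN ⊢
    omega
  obtain ⟨u, rfl⟩ := exists_coord_eq_iff.2 ⟨hx, hxN⟩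
  obtain ⟨s, rfl⟩ := exists_coord_eq_iff.2 ⟨hy, hyN⟩
  obtain ⟨t, ht⟩ := hf.exists_coord_eq_apply s
  have hfs : f (coord t) = coord s := by rw [ht, hf.involutive]
  have hne : f (coord s) ≠ f (coord u) := hf.involutive.injective.ne hxy.ne'
  have hne' : f (coord s) ≠ coord u := fun h => hyx.ne (hf.involutive.eq_iff.1 h)
  have hleft := h t u
  have hright := h u s hxy hyx
  rw [hfs, ht] at hleft
  omega

theorem IsNonCrossingDiagram.exists_isMatching (hD : IsNonCrossingDiagram D) :
    ∃ f, IsMatching (n + 1) f ∧ IsPlanar f ∧ toDiagram n f = D := by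
  obtain ⟨p, hp, hjoined⟩ := hD.exists_partner
  have hpu (u : Dot n) : Joined D u (p u) := (hjoined u _).2 rfl
  obtain ⟨f, hf, hfp⟩ := exists_isMatching_extending hp fun u => (hD.ne_of_joined (hpu u)).symm
  refine ⟨f, hf, hf.isPlanar fun u s hus hsu hcross => ?_, ?_⟩
  · rw [hfp] at hsu
    rw [hfp, hfp] at hcross
    exact hD.not_joined_of_coord_lt hus hsu hcross ⟨hpu u, hpu s⟩
  · ext ⟨u, v⟩
    simp only [toDiagram, Set.mem_ofPred_eq, hfp, coord_injective.eq_iff]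
    rw [hD.mem_iff, hjoined]

end Diagrams

section Concatenation

/-! ### The product of a diagram with a generator -/

variable {n : ℕ} {D₁ D₂ : Set (Dot n × Dot n)} {d e : Dot n} {f : ℤ → ℤ} {k : Fin n}

theorem reachable_of_mem_left (h : (d, e) ∈ D₁) :
    (stackGraph D₁ D₂).Reachable (place 0 1 d) (place 0 1 e) := by
  by_cases hne : place 0 1 d = place 0 1 e
  · rw [hne]
  · exact SimpleGraph.Adj.reachable ⟨hne, .inl (.inl ⟨_, h, rfl, rfl⟩)⟩

theorem reachable_of_mem_right (h : (d, e) ∈ D₂) :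
    (stackGraph D₁ D₂).Reachable (place 1 2 d) (place 1 2 e) := by
  by_cases hne : place 1 2 d = place 1 2 e
  · rw [hne]
  · exact SimpleGraph.Adj.reachable ⟨hne, .inl (.inr ⟨_, h, rfl, rfl⟩)⟩

theorem eq_of_stackGraph_reachable {α : Type*} (c : StackDot n → α)
    (h₁ : ∀ a ∈ D₁, c (place 0 1 a.1) = c (place 0 1 a.2))
    (h₂ : ∀ a ∈ D₂, c (place 1 2 a.1) = c (place 1 2 a.2)) {u v : StackDot n}
    (h : (stackGraph D₁ D₂).Reachable u v) : c u = c v := by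
  rw [SimpleGraph.reachable_iff_reflTransGen] at h
  induction h with
  | refl => rfl
  | tail _ hadj ih =>
    refine ih.trans ?_
    rcases hadj.2 with (⟨a, ha, rfl, rfl⟩ | ⟨a, ha, rfl, rfl⟩) |
      ⟨a, ha, rfl, rfl⟩ | ⟨a, ha, rfl, rfl⟩
    exacts [h₁ a ha, h₂ a ha, (h₁ a ha).symm, (h₂ a ha).symm]

theorem reachable_of_apply_coord_eq (hf : f.Involutive) (h : f (coord d) = coord e) :
    (stackGraph (toDiagram n f) D₂).Reachable (place 0 1 d) (place 0 1 e) := by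
  rcases lt_trichotomy d e with hlt | rfl | hlt
  · exact reachable_of_mem_left ⟨hlt, h⟩
  · exact .rfl
  · have hed : (e, d) ∈ toDiagram n f := ⟨hlt, (hf.eq_iff.1 h).symm⟩
    exact (reachable_of_mem_left hed).symm

theorem coord_bot_castSucc (k : Fin n) : coord (bot k.castSucc) = (k : ℤ) + 1 := rfl

theorem coord_bot_succ (k : Fin n) : coord (bot k.succ) = (k : ℤ) + 2 := by
  rw [coord_bot, Fin.val_succ]
  push_cast
  ring

theorem reachable_genDiagram_middle (D₁ : Set (Dot n × Dot n)) (k : Fin n) :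
    (stackGraph D₁ (genDiagram k)).Reachable (1, k.castSucc) (1, k.succ) :=
  reachable_of_mem_right (d := top k.castSucc) (e := top k.succ) (.inl (.inl rfl))

theorem reachable_genDiagram_bottom (D₁ : Set (Dot n × Dot n)) (k : Fin n) :
    (stackGraph D₁ (genDiagram k)).Reachable (2, k.castSucc) (2, k.succ) :=
  reachable_of_mem_right (d := bot k.castSucc) (e := bot k.succ) (.inl (.inr rfl))

theorem reachable_genDiagram_vertical (D₁ : Set (Dot n × Dot n)) {x : Fin (n + 1)}
    (h : x ≠ k.castSucc) (h' : x ≠ k.succ) :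
    (stackGraph D₁ (genDiagram k)).Reachable (1, x) (2, x) :=
  reachable_of_mem_right (d := top x) (e := bot x) (.inr ⟨x, h, h', rfl⟩)

theorem reachable_place (D₁ : Set (Dot n × Dot n)) (h : coord d ≠ k + 1) (h' : coord d ≠ k + 2) :
    (stackGraph D₁ (genDiagram k)).Reachable (place 0 1 d) (place 0 2 d) := by
  rcases exists_eq_top_or_exists_eq_bot d with ⟨x, rfl⟩ | ⟨x, rfl⟩
  · exact .rfl
  · apply reachable_genDiagram_vertical
    · rintro rfl
      exact h (coord_bot_castSucc k)
    · rintro rfl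
      exact h' (coord_bot_succ k)

theorem reachable_partners (hf : IsMatching (n + 1) f) (hcup : f (k + 1) ≠ k + 2)
    (hd : coord d = f (k + 1)) (he : coord e = f (k + 2)) :
    (stackGraph (toDiagram n f) (genDiagram k)).Reachable (place 0 2 d) (place 0 2 e) := by
  have hcup' : f (k + 2) ≠ k + 1 := fun h => hcup (hf.involutive.eq_iff.1 h).symm
  have hd' := reachable_place (toDiagram n f) (d := d) (by rw [hd]; exact hf.ne _ (by omega))
    (by rwa [hd])
  have he' := reachable_place (toDiagram n f) (d := e) (by rwa [he])
    (by rw [he]; exact hf.ne _ (by omega))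
  have hleft := reachable_of_apply_coord_eq (D₂ := genDiagram k) (d := bot k.castSucc) (e := d)
    hf.involutive (by rw [hd, coord_bot_castSucc])
  have hright := reachable_of_apply_coord_eq (D₂ := genDiagram k) (d := bot k.succ) (e := e)
    hf.involutive (by rw [he, coord_bot_succ])
  exact hd'.symm.trans <| hleft.symm.trans <|
    (reachable_genDiagram_middle _ k).trans <| hright.trans he'

theorem reachable_of_reconnect (hf : IsMatching (n + 1) f)
    (h : reconnect ((k : ℤ) + 1) (k + 2) f (coord d) = coord e) :
    (stackGraph (toDiagram n f) (genDiagram k)).Reachable (place 0 2 d) (place 0 2 e) := by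
  have hl := coord_bot_castSucc k
  have hr := coord_bot_succ k
  have hinv := hf.involutive
  unfold reconnect at h
  split_ifs at h with hdl hdr hfl hfr
  · rw [coord_injective (hdl.trans hl.symm), coord_injective (h.symm.trans hr.symm)]
    exact reachable_genDiagram_bottom _ k
  · rw [coord_injective (hdr.trans hr.symm), coord_injective (h.symm.trans hl.symm)]
    exact (reachable_genDiagram_bottom _ k).symm
  · exact reachable_partners hf (by rwa [← hfl]) hfl h.symm
  · refine (reachable_partners hf (fun hcup => hdl ?_) h.symm hfr).symm
    rw [hfr, ← hcup, hinv]
  · have hd := reachable_place (toDiagram n f) hdl hdr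
    have he := reachable_place (toDiagram n f) (d := e) (k := k)
      (by rw [← h]; exact fun h => hfl (hinv.eq_iff.1 h))
      (by rw [← h]; exact fun h => hfr (hinv.eq_iff.1 h))
    exact hd.symm.trans <| (reachable_of_apply_coord_eq hinv h).trans he

/-- In the drawing of an arc between `a` and `b` below the involution `f`, the endpoints of the
line through the dot `z` of `f`, before `a` and `b` are joined anew. When `f a = b`, the line
through `a` is a circle and the value is immaterial. -/
def lineEnds (a b : ℤ) (f : ℤ → ℤ) (z : ℤ) : Sym2 ℤ :=
  if z = a ∨ z = b then s(f a, f b) else s(z, reconnect a b f z)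

theorem lineEnds_apply {a b : ℤ} (hf : f.Involutive) (ha : f a ≠ a) (hb : f b ≠ b) (z : ℤ) :
    lineEnds a b f (f z) = lineEnds a b f z := by
  have hz := hf z
  have hfa := hf a
  have hfb := hf b
  grind [lineEnds, reconnect, Sym2.eq_swap]

/-- The endpoints of the line through a dot, when the generator `k` is placed below the diagram of
`f`. -/
def stackLineEnds (f : ℤ → ℤ) (k : Fin n) : StackDot n → Sym2 ℤ
  | (0, x) => lineEnds (k + 1) (k + 2) f (coord (top x))
  | (1, x) => lineEnds (k + 1) (k + 2) f (coord (bot x))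
  | (2, x) => s(coord (bot x), reconnect ((k : ℤ) + 1) (k + 2) f (coord (bot x)))

theorem stackLineEnds_place_zero_one (d : Dot n) :
    stackLineEnds f k (place 0 1 d) = lineEnds (k + 1) (k + 2) f (coord d) := by
  rcases exists_eq_top_or_exists_eq_bot d with ⟨x, rfl⟩ | ⟨x, rfl⟩ <;> rfl

theorem stackLineEnds_place_zero_two (d : Dot n) : stackLineEnds f k (place 0 2 d) =
    s(coord d, reconnect ((k : ℤ) + 1) (k + 2) f (coord d)) := by
  rcases exists_eq_top_or_exists_eq_bot d with ⟨x, rfl⟩ | ⟨x, rfl⟩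
  · have hx : ¬ (coord (top x) = (k : ℤ) + 1 ∨ coord (top x) = (k : ℤ) + 2) := by
      rw [coord_top]
      omega
    exact (if_neg hx : lineEnds _ _ f _ = _)
  · rfl

theorem stackLineEnds_eq_of_mem_genDiagram {a : Dot n × Dot n} (ha : a ∈ genDiagram k) :
    stackLineEnds f k (place 1 2 a.1) = stackLineEnds f k (place 1 2 a.2) := by
  have hl := coord_bot_castSucc k
  have hr := coord_bot_succ k
  rcases ha with (rfl | rfl) | ⟨x, hxl, hxr, rfl⟩
  · change lineEnds _ _ f (coord (bot k.castSucc)) = lineEnds _ _ f (coord (bot k.succ))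
    rw [lineEnds, lineEnds, if_pos (.inl hl), if_pos (.inr hr)]
  · change s(coord (bot k.castSucc), _) = s(coord (bot k.succ), _)
    rw [hl, hr, reconnect_apply_left, reconnect_apply_right, Sym2.eq_swap]
  · have hx : ¬ (coord (bot x) = (k : ℤ) + 1 ∨ coord (bot x) = (k : ℤ) + 2) := by
      rw [Fin.ne_iff_vne, Fin.val_castSucc] at hxl
      rw [Fin.ne_iff_vne, Fin.val_succ] at hxr
      rw [coord_bot]
      omega
    exact if_neg hx

theorem concat_genDiagram (hf : IsMatching (n + 1) f) (k : Fin n) :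
    concat (toDiagram n f) (genDiagram k) = toDiagram n (reconnect ((k : ℤ) + 1) (k + 2) f) := by
  ext ⟨d, e⟩
  refine and_congr_right fun hlt => ⟨fun h => ?_, reachable_of_reconnect hf⟩
  have hends := eq_of_stackGraph_reachable (stackLineEnds f k) (fun a ha => ?_)
    (fun a => stackLineEnds_eq_of_mem_genDiagram) h
  · rw [stackLineEnds_place_zero_two, stackLineEnds_place_zero_two, Sym2.eq_iff] at hends
    exact hends.elim (fun h => absurd (coord_injective h.1) hlt.ne) And.right
  · rw [stackLineEnds_place_zero_one, stackLineEnds_place_zero_one, ← ha.2,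
      lineEnds_apply hf.involutive (hf.ne _ (by omega)) (hf.ne _ (by omega))]

theorem exists_reachable_place (hf : IsMatching (n + 1) f) (hcup : f (k + 1) ≠ k + 2)
    (v : StackDot n) :
    ∃ e, (stackGraph (toDiagram n f) (genDiagram k)).Reachable v (place 0 2 e) := by
  match v with
  | (0, x) => exact ⟨top x, .rfl⟩
  | (2, x) => exact ⟨bot x, .rfl⟩
  | (1, x) =>
    by_cases h : x = k.castSucc ∨ x = k.succ
    · obtain ⟨e, he⟩ := hf.exists_coord_eq_apply (bot k.castSucc)
      have hupper := reachable_of_apply_coord_eq (D₂ := genDiagram k) hf.involutive he.symm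
      rw [coord_bot_castSucc] at he
      have hlower := reachable_place (toDiagram n f) (d := e) (k := k)
        (by rw [he]; exact hf.ne _ (by omega)) (by rwa [he])
      refine ⟨e, .trans ?_ (hupper.trans hlower)⟩
      rcases h with rfl | rfl
      exacts [.rfl, (reachable_genDiagram_middle _ k).symm]
    · rw [not_or] at h
      exact ⟨bot x, reachable_genDiagram_vertical _ h.1 h.2⟩

theorem circles_genDiagram_eq_zero (hf : IsMatching (n + 1) f) (hcup : f (k + 1) ≠ k + 2) :
    circles (toDiagram n f) (genDiagram k) = 0 := by
  rw [circles, Set.ncard_eq_zero, Set.eq_empty_iff_forall_notMem]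
  rintro ⟨v⟩ hmid
  obtain ⟨e, he⟩ := exists_reachable_place hf hcup v
  have hrow := hmid _ (SimpleGraph.ConnectedComponent.sound he.symm)
  rcases exists_eq_top_or_exists_eq_bot e with ⟨x, rfl⟩ | ⟨x, rfl⟩
  · exact absurd hrow (by decide : (0 : Fin 3) ≠ 1)
  · exact absurd hrow (by decide : (2 : Fin 3) ≠ 1)

theorem IsShortest.monomial_eq {ω : List (Fin n)} (h : IsShortest ω) :
    monomial ω = (0, toDiagram n (wordMatching ω)) := by
  induction ω using List.reverseRecOn with
  | nil => exact congrArg (Prod.mk 0) idDiagram_eq_toDiagram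
  | append_singleton ω k ih =>
    have hm := isMatching_wordMatching ω
    have happend : monomial (ω ++ [k]) = ((monomial ω).1 + circles (monomial ω).2 (genDiagram k),
        concat (monomial ω).2 (genDiagram k)) := List.foldl_append
    rw [happend, ih h.of_append, circles_genDiagram_eq_zero hm h.apply_ne,
      concat_genDiagram hm, wordMatching_append_singleton]

end Concatenation

section TailsAndHeads

/-! ### Tails, heads and size of a diagram -/

variable {n : ℕ} {f : ℤ → ℤ} {a : Dot n × Dot n}

theorem mem_topArrows_union_posArrows_toDiagram_iff :
    a ∈ topArrows (toDiagram n f) ∪ posArrows (toDiagram n f) ↔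
      ∃ x, a.1 = top x ∧ f (coord (top x)) = coord a.2 ∧ IsTail f (x + 1) := by
  obtain ⟨d, e⟩ := a
  simp only [topArrows, posArrows, toDiagram, Set.mem_union, Set.mem_ofPred_eq, Prod.mk.injEq,
    IsTail, ← coord_top]
  constructor
  · rintro (⟨⟨hlt, h⟩, x, y, rfl, rfl⟩ | ⟨⟨-, h⟩, x, y, ⟨rfl, rfl⟩, hxy⟩) <;>
      refine ⟨x, rfl, h, ?_⟩ <;> rw [h]
    · rw [Sum.Lex.inl_lt_inl_iff] at hlt
      simp only [coord_top]
      omega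
    · rw [Sum.Lex.inr_lt_inr_iff] at hxy
      simp only [coord_bot]
      omega
  · rintro ⟨x, rfl, h, htail⟩
    rw [h] at htail
    rcases exists_eq_top_or_exists_eq_bot e with ⟨y, rfl⟩ | ⟨y, rfl⟩
    · simp only [coord_top] at htail
      exact .inl ⟨⟨Sum.Lex.inl_lt_inl_iff.2 (by omega), h⟩, x, y, rfl, rfl⟩
    · simp only [coord_top, coord_bot] at htail
      exact .inr ⟨⟨Sum.Lex.inl_lt_inr x y, h⟩, x, y, ⟨rfl, rfl⟩,
        Sum.Lex.inr_lt_inr_iff.2 (by omega)⟩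

theorem mem_botArrows_union_posArrows_toDiagram_iff (hf : f.Involutive) :
    a ∈ botArrows (toDiagram n f) ∪ posArrows (toDiagram n f) ↔
      ∃ y, a.2 = bot y ∧ f (coord (bot y)) = coord a.1 ∧ IsHead f (y + 1) := by
  obtain ⟨d, e⟩ := a
  simp only [botArrows, posArrows, toDiagram, Set.mem_union, Set.mem_ofPred_eq, Prod.mk.injEq,
    IsHead, ← coord_bot, hf.eq_iff (x := coord d), eq_comm (a := coord d)]
  constructor
  · rintro (⟨⟨hlt, h⟩, x, y, rfl, rfl⟩ | ⟨⟨-, h⟩, x, y, ⟨rfl, rfl⟩, hxy⟩) <;>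
      refine ⟨y, rfl, h, ?_⟩ <;> rw [h]
    · rw [Sum.Lex.inr_lt_inr_iff] at hlt
      simp only [coord_bot]
      omega
    · rw [Sum.Lex.inr_lt_inr_iff] at hxy
      simp only [coord_top, coord_bot]
      omega
  · rintro ⟨y, rfl, h, hhead⟩
    rw [h] at hhead
    rcases exists_eq_top_or_exists_eq_bot d with ⟨x, rfl⟩ | ⟨x, rfl⟩
    · simp only [coord_top, coord_bot] at hhead
      exact .inr ⟨⟨Sum.Lex.inl_lt_inr x y, h⟩, x, y, ⟨rfl, rfl⟩,
        Sum.Lex.inr_lt_inr_iff.2 (by omega)⟩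
    · simp only [coord_bot] at hhead
      exact .inl ⟨⟨Sum.Lex.inr_lt_inr_iff.2 (by omega), h⟩, x, y, rfl, rfl⟩

theorem mem_tailSet_toDiagram_iff (hf : IsMatching (n + 1) f) {i : ℕ} :
    i ∈ tailSet (toDiagram n f) ↔ 0 < i ∧ IsTail f i := by
  simp only [tailSet, Set.mem_ofPred_eq, mem_topArrows_union_posArrows_toDiagram_iff]
  constructor
  · rintro ⟨x, e, rfl, x', hx, -, htail⟩
    obtain rfl := Sum.inl_injective hx
    exact ⟨by omega, by exact_mod_cast htail⟩
  · rintro ⟨hi, htail⟩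
    have hin : i ≤ n + 1 := by
      by_contra! h
      have hout := hf.eq_neg (-i) (by rw [abs_neg, Nat.abs_cast]; omega)
      unfold IsTail at htail
      omega
    obtain ⟨x, rfl⟩ := Nat.exists_eq_add_of_le' hi
    obtain ⟨e, he⟩ := hf.exists_coord_eq_apply (top ⟨x, hin⟩)
    exact ⟨⟨x, hin⟩, e, rfl, _, rfl, he.symm, by exact_mod_cast htail⟩

theorem mem_headSet_toDiagram_iff (hf : IsMatching (n + 1) f) {j : ℕ} :
    j ∈ headSet (toDiagram n f) ↔ 0 < j ∧ IsHead f (j + 1) := by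
  simp only [headSet, Set.mem_ofPred_eq, mem_botArrows_union_posArrows_toDiagram_iff hf.involutive]
  constructor
  · rintro ⟨hj, -, d, y, hy, y', hy', -, hhead⟩
    obtain rfl := Sum.inr_injective hy'
    obtain rfl : j = y := by omega
    exact ⟨hj, hhead⟩
  · rintro ⟨hj, hhead⟩
    have hjn : j < n + 1 := by
      by_contra! h
      have hout := hf.eq_neg (j + 1) (by rw [lt_abs]; omega)
      unfold IsHead at hhead
      omega
    obtain ⟨d, hd⟩ := hf.exists_coord_eq_apply (bot ⟨j, hjn⟩)
    exact ⟨hj, hjn.le, d, ⟨j, hjn⟩, rfl, _, rfl, hd.symm, hhead⟩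

theorem size_toDiagram (n : ℕ) (f : ℤ → ℤ) :
    size (toDiagram n f) = (tailSet (toDiagram n f)).ncard := by
  have himage : tailSet (toDiagram n f) = (fun a => (coord a.1).natAbs) ''
      (topArrows (toDiagram n f) ∪ posArrows (toDiagram n f)) := by
    ext i
    constructor
    · rintro ⟨x, e, rfl, h⟩
      exact ⟨_, h, by simp only [coord_top]; omega⟩
    · rintro ⟨⟨d, e⟩, h, rfl⟩
      obtain ⟨x, rfl, -⟩ := mem_topArrows_union_posArrows_toDiagram_iff.1 h
      exact ⟨x, e, by simp only [coord_top]; omega, h⟩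
  rw [himage, Set.InjOn.ncard_image, size]
  rintro ⟨d, e⟩ h ⟨d', e'⟩ h' heq
  obtain ⟨x, rfl, he, -⟩ := mem_topArrows_union_posArrows_toDiagram_iff.1 h
  obtain ⟨x', rfl, he', -⟩ := mem_topArrows_union_posArrows_toDiagram_iff.1 h'
  simp only [coord_top] at heq
  obtain rfl : x = x' := by omega
  exact congrArg (Prod.mk (top x)) (coord_injective (he.symm.trans he'))

end TailsAndHeads

section NormalDiagrams

/-! ### The diagram of a normal list -/

variable {n : ℕ} {L L' : List (ℕ × ℕ)}

/-- The diagram of the element of `W(A_n)` with normal form `[i₁, j₁] ⋯ [i_p, j_p]`. -/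
def normalDiagram (n : ℕ) (L : List (ℕ × ℕ)) : Set (Dot n × Dot n) :=
  toDiagram n (wordMatching (normalWord n L))

theorem IsNormal.tailSet_normalDiagram (hL : IsNormal n L) :
    tailSet (normalDiagram n L) = {i | ∃ q ∈ L, q.1 = i} := by
  ext i
  rw [normalDiagram, mem_tailSet_toDiagram_iff (isMatching_wordMatching _)]
  exact hL.exists_fst_eq_iff.symm

theorem IsNormal.headSet_normalDiagram (hL : IsNormal n L) :
    headSet (normalDiagram n L) = {j | ∃ q ∈ L, q.2 = j} := by
  ext j
  rw [normalDiagram, mem_headSet_toDiagram_iff (isMatching_wordMatching _), Set.mem_ofPred_eq,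
    ← hL.exists_snd_eq_iff, and_iff_right_of_imp]
  rintro ⟨q, hq, rfl⟩
  have := hL.2 q hq
  omega

theorem IsNormal.size_normalDiagram (hL : IsNormal n L) : size (normalDiagram n L) = L.length := by
  have hnodup : (L.map Prod.fst).Nodup :=
    List.nodup_iff_pairwise_ne.2 (List.pairwise_map.2 (hL.1.imp fun h => h.1.ne'))
  have htails : tailSet (normalDiagram n L) = ((L.map Prod.fst).toFinset : Set ℕ) := by
    ext i
    simp [hL.tailSet_normalDiagram]
  rw [normalDiagram, size_toDiagram, ← normalDiagram, htails, Set.ncard_coe_finset,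
    List.toFinset_card_of_nodup hnodup, List.length_map]

theorem IsNormal.eq_of_tailSet_eq (hL : IsNormal n L) (hL' : IsNormal n L')
    (htail : tailSet (normalDiagram n L) = tailSet (normalDiagram n L'))
    (hhead : headSet (normalDiagram n L) = headSet (normalDiagram n L')) : L = L' := by
  rw [hL.tailSet_normalDiagram, hL'.tailSet_normalDiagram] at htail
  rw [hL.headSet_normalDiagram, hL'.headSet_normalDiagram] at hhead
  exact hL.eq_of_mem_iff hL' (Set.ext_iff.1 htail) (Set.ext_iff.1 hhead)

theorem IsNonCrossingDiagram.exists_isNormal {D : Set (Dot n × Dot n)}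
    (hD : IsNonCrossingDiagram D) : ∃ L, IsNormal n L ∧ normalDiagram n L = D := by
  obtain ⟨f, hf, hp, rfl⟩ := hD.exists_isMatching
  obtain ⟨L, hL, rfl⟩ := exists_isNormal_wordMatching_eq hf hp
  exact ⟨L, hL, rfl⟩

theorem IsNormal.isBraidFree_normalWord (hL : IsNormal n L) :
    IsBraidFree (CoxeterMatrix.A n) (normalWord n L) :=
  hL.isShortest_normalWord.isBraidFree

theorem IsNormal.isReduced_normalWord (hL : IsNormal n L) :
    (cox n).IsReduced (normalWord n L) :=
  hL.isBraidFree_normalWord.isReduced (cox n) isSimplyLaced_typeA cox_simple_injective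

theorem IsNormal.isFullyCommutative_wordProd (hL : IsNormal n L) :
    IsFullyCommutative (cox n) ((cox n).wordProd (normalWord n L)) :=
  hL.isBraidFree_normalWord.isFullyCommutative (cox n) isSimplyLaced_typeA cox_simple_injective

theorem IsNormal.monomial_normalWord (hL : IsNormal n L) :
    monomial (normalWord n L) = (0, normalDiagram n L) :=
  hL.isShortest_normalWord.monomial_eq

theorem IsNormal.isDiagramOf_normalDiagram (hL : IsNormal n L) :
    IsDiagramOf ((cox n).wordProd (normalWord n L)) (normalDiagram n L) := by
  intro ω hω hprod
  have hequiv : CommEquiv (CoxeterMatrix.A n) (normalWord n L) ω :=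
    hL.isFullyCommutative_wordProd _ _ hL.isReduced_normalWord hω rfl hprod
  rw [(hL.isShortest_normalWord.commEquiv hequiv).monomial_eq, ← hequiv.wordMatching_eq,
    normalDiagram]

theorem IsNormal.eq_wordProd_of_isDiagramOf (hL : IsNormal n L) {w : (CoxeterMatrix.A n).Group}
    (hw : IsFullyCommutative (cox n) w) (hD : IsDiagramOf w (normalDiagram n L)) :
    w = (cox n).wordProd (normalWord n L) := by
  obtain ⟨ω, hω, rfl⟩ := (cox n).exists_isReduced w
  obtain ⟨L', hL', hequiv⟩ := (hw.isBraidFree (cox n) hω).exists_isNormal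
  have hdiag : normalDiagram n L' = normalDiagram n L := congrArg Prod.snd <|
    hL'.monomial_normalWord.symm.trans <|
      hD _ (hequiv.isReduced (cox n) hω) (hequiv.wordProd_eq (cox n)).symm
  rw [hequiv.wordProd_eq (cox n), hL'.eq_of_tailSet_eq hL (by rw [hdiag]) (by rw [hdiag])]

theorem pairsWord_getElem (n : ℕ) (L : List (ℕ × ℕ)) :
    pairsWord n (fun k : Fin L.length => L[k].1) (fun k => L[k].2) = normalWord n L := by
  have hofFn : (List.ofFn fun k : Fin L.length => block n L[k].1 L[k].2) =
      L.map fun q => block n q.1 q.2 := by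
    conv_rhs => rw [← List.ofFn_getElem (xs := L), List.map_ofFn]
    rfl
  rw [pairsWord, hofFn, normalWord, List.flatMap_def]

theorem range_apply_getElem {α β : Type*} (g : α → β) (l : List α) :
    (Set.range fun k : Fin l.length => g l[k]) = {b | ∃ a ∈ l, g a = b} := by
  ext b
  simp [List.mem_iff_getElem, Fin.exists_iff]

end NormalDiagrams

end FCDiagram

theorem mainTheorem3 (n : ℕ) (D : Set (FCDiagram.Dot n × FCDiagram.Dot n))
    (hD : FCDiagram.IsNonCrossingDiagram D) :
    (∃ i j : Fin (FCDiagram.size D) → ℕ,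
      StrictAnti i ∧ StrictAnti j ∧
      Set.range i = FCDiagram.tailSet D ∧ Set.range j = FCDiagram.headSet D ∧
      (∀ k, 1 ≤ i k ∧ i k ≤ j k ∧ j k ≤ n) ∧
      (FCDiagram.cox n).IsReduced (FCDiagram.pairsWord n i j) ∧
      FCDiagram.IsFullyCommutative (FCDiagram.cox n)
        ((FCDiagram.cox n).wordProd (FCDiagram.pairsWord n i j)) ∧
      FCDiagram.IsDiagramOf ((FCDiagram.cox n).wordProd (FCDiagram.pairsWord n i j)) D ∧
      ∀ w : (CoxeterMatrix.A n).Group, FCDiagram.IsFullyCommutative (FCDiagram.cox n) w →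
        FCDiagram.IsDiagramOf w D →
        w = (FCDiagram.cox n).wordProd (FCDiagram.pairsWord n i j)) ∧
    ∀ D' : Set (FCDiagram.Dot n × FCDiagram.Dot n), FCDiagram.IsNonCrossingDiagram D' →
      FCDiagram.tailSet D' = FCDiagram.tailSet D → FCDiagram.headSet D' = FCDiagram.headSet D →
      D' = D := by
  obtain ⟨L, hL, rfl⟩ := hD.exists_isNormal
  refine ⟨?_, fun D' hD' htail hhead => ?_⟩
  · rw [hL.size_normalDiagram]
    have hanti := List.pairwise_iff_get.1 hL.1
    refine ⟨fun k => L[k].1, fun k => L[k].2, fun a b hab => (hanti a b hab).1,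
      fun a b hab => (hanti a b hab).2, ?_, ?_, fun k => hL.2 _ (List.getElem_mem _), ?_⟩
    · rw [hL.tailSet_normalDiagram, FCDiagram.range_apply_getElem Prod.fst]
    · rw [hL.headSet_normalDiagram, FCDiagram.range_apply_getElem Prod.snd]
    · rw [FCDiagram.pairsWord_getElem]
      exact ⟨hL.isReduced_normalWord, hL.isFullyCommutative_wordProd,
        hL.isDiagramOf_normalDiagram, fun w => hL.eq_wordProd_of_isDiagramOf⟩
  · obtain ⟨L', hL', rfl⟩ := hD'.exists_isNormal
    rw [hL'.eq_of_tailSet_eq hL htail hhead]
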